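/- **Conventions.** Let $k$ be a field and $R$ a $k$-algebra that is Frobenius-separable, with a fixed idempotent Frobenius system $(\phi,e)$: $\phi\colon R\to k$ is $k$-linear, $e=e^1\otimes e^2\in R\otimes R$, $\phi(re^1)e^2=r=e^1\phi(e^2r)$ for all $r\in R$, and $e^1e^2=1$. Write $\overline R=R^{op}$, $r\mapsto\overline r$, and $R^e=R\otimes\overline R$. Unadorned tensor products are over $k$. An $R^e$-ring is a $k$-algebra $L$ with a $k$-algebra map $R^e\to L$, by which elements of $R^e$ are regarded as elements of $L$. Let $L\diamond L$ be the quotient of $L\otimes L$ by the relations $\overline r m\otimes n=m\otimes rn$, and let $L\times_RL\subset L\diamond L$ consist of all $\sum m_i\otimes n_i$ with $\sum m_i\overline s\otimes n_i=\sum m_i\otimes n_is$ for all $s\in R$; it is an $R^e$-ring under componentwise multiplication and $r\otimes\overline s\mapsto r\otimes\overline s$. A $\times_R$-bialgebra is an $R^e$-ring $L$ with maps of $R^e$-rings $\Gamma\colon L\to L\times_RL$, $\Gamma(\ell)=\ell_{[1]}\otimes\ell_{[2]}$, and $C\colon L\to\operatorname{End}_k(R)$ (where $r\otimes\overline s\in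 R^e$ acts on $R$ by $t\mapsto rts$), such that $\Gamma$ is coassociative (in the quotient of $L\otimes L\otimes L$ by $\overline r m\otimes p\otimes n=m\otimes rp\otimes n$ and $m\otimes\overline t p\otimes n=m\otimes p\otimes tn$) and $\overline{C(\ell_{[2]})(1)}\,\ell_{[1]}=\ell=C(\ell_{[1]})(1)\,\ell_{[2]}$. A weak bialgebra is a $k$-algebra and $k$-coalgebra $W$ with multiplicative comultiplication such that $$\epsilon(fgh)=\epsilon(fg_{(1)})\epsilon(g_{(2)}h)=\epsilon(fg_{(2)})\epsilon(g_{(1)}h),$$ $$1_{(1)}\otimes1_{(2)}\otimes1_{(3)}=(\Delta(1)\otimes1)(1\otimes\Delta(1))=(1\otimes\Delta(1))(\Delta(1)\otimes1).$$ The weak bialgebra corresponding to a $\times_R$-bialgebra $L$ (and to $(\phi,e)$) is the algebra $L$ with $\Delta(\ell)=\overline{e^1}\ell_{[1]}\otimes e^2\ell_{[2]}$ and $\epsilon(\ell)=\phi(C(\ell)(1))$. The dual $W^*=\operatorname{Hom}_k(W,k)$ of a finite-dimensional weak bialgebra has $(fg)(w)=f(w_{(1)})g(w_{(2)})$, unit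 $\epsilon$, $f_{(1)}(v)f_{(2)}(w)=f(vw)$ and counit $f\mapsto f(1)$; $(W^*)^{op}$ has the reversed multiplication and the same comultiplication. A skew pairing of $\times_R$-bialgebras $\Lambda,H$ is a $k$-linear map $\tau\colon\Lambda\otimes H\to R$ with $$\tau((r\otimes\overline s)\xi(t\otimes\overline u)|h)v=r\,\tau(\xi|(t\otimes\overline v)h(u\otimes\overline s)),$$ $$\tau(\xi|gh)=\tau(\overline{\tau(\xi_{[2]}|h)}\,\xi_{[1]}|g),\qquad\tau(\xi|1)=C(\xi)(1),$$ $$\tau(\xi\zeta|g)=\tau(\xi|\tau(\zeta|g_{[1]})g_{[2]}),\qquad\tau(1|h)=C(h)(1)$$ for all $r,s,t,u,v\in R$, $\xi,\zeta\in\Lambda$ and $g,h\in H$. **Proposition.** Let $H$ be a $\times_R$-bialgebra that is finite-dimensional over $k$, and let $$H^\vee=\operatorname{Hom}_{\overline R-}(H,R)=\{\xi\in\operatorname{Hom}_k(H,R)\mid\xi(\overline rh)=\xi(h)r\ \text{ for all } r\in R,\ h\in H\}.$$ Then: 1. The algebra $H$ with the above $\Delta$ and $\epsilon$ is indeed a weak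 bialgebra, and so are its dual $H^*$ and $(H^*)^{op}$. 2. There is exactly one $\times_R$-bialgebra structure on the vector space $H^\vee$ for which the evaluation $\xi\otimes h\mapsto\xi(h)$ is a skew pairing $H^\vee\otimes H\to R$. 3. The weak bialgebra corresponding to $H^\vee$ with this structure is the opposite $(H^*)^{op}$ of the dual of the weak bialgebra corresponding to $H$: the map $H^\vee\to H^*$, $\xi\mapsto\phi\circ\xi$, is a $k$-linear bijection, and it is an isomorphism of weak bialgebras $H^\vee\to(H^*)^{op}$. -/

import Mathlib

open scoped TensorProduct

noncomputable section

universe u v w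

/-- An idempotent Frobenius system `(φ, e)` for a `k`-algebra `R`: a linear form `φ` and a tensor
`e = e¹ ⊗ e²` with `φ(r e¹) e² = r = e¹ φ(e² r)` for all `r`, and `e¹ e² = 1`. The algebra `R` is
Frobenius-separable if such a system exists. -/
structure IdempotentFrobeniusSystem (k : Type u) (R : Type v) [Field k] [Ring R] [Algebra k R] where
  φ : R →ₗ[k] k
  e : R ⊗[k] R
  left_id : ∀ r : R,
    TensorProduct.lid k R (TensorProduct.map (φ ∘ₗ LinearMap.mulLeft k r) LinearMap.id e) = r
  right_id : ∀ r : R,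
    TensorProduct.rid k R (TensorProduct.map LinearMap.id (φ ∘ₗ LinearMap.mulRight k r) e) = r
  mul_e : LinearMap.mul' k R e = 1

/-- The Casimir property `x e¹ ⊗ e² = e¹ ⊗ e² x`. -/
theorem IdempotentFrobeniusSystem.casimir {k : Type u} {R : Type v} [Field k] [Ring R] [Algebra k R]
    (F : IdempotentFrobeniusSystem k R) (x : R) :
    TensorProduct.map (LinearMap.mulLeft k x) LinearMap.id F.e =
      TensorProduct.map LinearMap.id (LinearMap.mulRight k x) F.e := by
  -- slicing by the functionals `φ(y ·)` determines a tensor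
  let P : R →ₗ[k] (R ⊗[k] R) →ₗ[k] R := LinearMap.mk₂ k
    (fun y z => TensorProduct.lid k R
      (TensorProduct.map (F.φ ∘ₗ LinearMap.mulLeft k y) LinearMap.id z))
    (by
      intro a b z
      induction z with
      | zero => simp
      | tmul c d => simp [add_mul, add_smul]
      | add p q hp hq => simp only [map_add, hp, hq]; abel)
    (by
      intro c a z
      induction z with
      | zero => simp
      | tmul p q => simp [mul_smul]
      | add p q hp hq => simp only [map_add, hp, hq, smul_add])
    (by intro a z z'; simp)
    (by intro a c z; simp)
  have key : ∀ z : R ⊗[k] R, TensorProduct.map LinearMap.id (P.flip z) F.e = z := by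
    intro z
    induction z with
    | zero => simp
    | tmul a b =>
      have h1 : P.flip (a ⊗ₜ[k] b) =
          (LinearMap.toSpanSingleton k R b) ∘ₗ (F.φ ∘ₗ LinearMap.mulRight k a) := by
        ext y; simp [P]
      have h2 : ∀ t : R ⊗[k] R,
          TensorProduct.map LinearMap.id
            ((LinearMap.toSpanSingleton k R b) ∘ₗ (F.φ ∘ₗ LinearMap.mulRight k a)) t =
          (TensorProduct.rid k R
            (TensorProduct.map LinearMap.id (F.φ ∘ₗ LinearMap.mulRight k a) t)) ⊗ₜ[k] b := by
        intro t
        induction t with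
        | zero => simp
        | tmul c d => simp [TensorProduct.smul_tmul]
        | add p q hp hq => simp only [map_add, hp, hq, TensorProduct.add_tmul]
      rw [h1, h2, F.right_id]
    | add p q hp hq =>
      rw [map_add, TensorProduct.map_add_right, LinearMap.add_apply, hp, hq]
  have hA : ∀ (y : R) (t : R ⊗[k] R),
      P y (TensorProduct.map (LinearMap.mulLeft k x) LinearMap.id t) = P (y * x) t := by
    intro y t
    induction t with
    | zero => simp
    | tmul c d => simp [P]
    | add p q hp hq => simp only [map_add, hp, hq]
  have hB : ∀ (y : R) (t : R ⊗[k] R),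
      P y (TensorProduct.map LinearMap.id (LinearMap.mulRight k x) t) = P y t * x := by
    intro y t
    induction t with
    | zero => simp
    | tmul c d => simp [P]
    | add p q hp hq => simp only [map_add, hp, hq, add_mul]
  have hP : ∀ y : R, P y F.e = y := fun y => F.left_id y
  rw [← key (TensorProduct.map (LinearMap.mulLeft k x) LinearMap.id F.e),
    ← key (TensorProduct.map LinearMap.id (LinearMap.mulRight k x) F.e)]
  congr 2
  ext y
  simp only [LinearMap.flip_apply]
  rw [hA, hB, hP, hP]

/-- An `Rᵉ`-ring structure on a `k`-vector space `L`, where `Rᵉ = R ⊗ Rᵒᵖ`: a `k`-algebra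
structure on `L` together with a `k`-algebra map `η : Rᵉ → L`. -/
structure EnvRing (k : Type u) (R : Type v) (L : Type w) [Field k] [Ring R] [Algebra k R]
    [AddCommGroup L] [Module k L] where
  mul : L →ₗ[k] L →ₗ[k] L
  one : L
  mul_assoc : ∀ a b c : L, mul (mul a b) c = mul a (mul b c)
  one_mul : ∀ a : L, mul one a = a
  mul_one : ∀ a : L, mul a one = a
  η : R ⊗[k] Rᵐᵒᵖ →ₗ[k] L
  η_one : η 1 = one
  η_mul : ∀ x y : R ⊗[k] Rᵐᵒᵖ, η (x * y) = mul (η x) (η y)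

namespace EnvRing

variable {k : Type u} {R : Type v} {L : Type w} [Field k] [Ring R] [Algebra k R]
  [AddCommGroup L] [Module k L] (A : EnvRing k R L)

/-- `r ↦ r` as a map `R → L`. -/
def src : R →ₗ[k] L := A.η ∘ₗ (TensorProduct.mk k R Rᵐᵒᵖ).flip 1

/-- `r ↦ r̄` as a map `R → L`. -/
def tgt : R →ₗ[k] L :=
  A.η ∘ₗ TensorProduct.mk k R Rᵐᵒᵖ 1 ∘ₗ (MulOpposite.opLinearEquiv k).toLinearMap

/-- The multiplication `(m ⊗ n)(m' ⊗ n') = mm' ⊗ nn'` of `L ⊗ L`. -/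
def tmul : L ⊗[k] L →ₗ[k] L ⊗[k] L →ₗ[k] L ⊗[k] L := TensorProduct.map₂ A.mul A.mul

/-- The subspace of `L ⊗ L` spanned by all `r̄ m ⊗ n - m ⊗ r n`. -/
def diamondRel : Submodule k (L ⊗[k] L) :=
  Submodule.span k {z | ∃ (r : R) (m n : L),
    z = A.mul (A.tgt r) m ⊗ₜ[k] n - m ⊗ₜ[k] A.mul (A.src r) n}

/-- `L ◇ L = ∫_r (r̄ L) ⊗ (r L)`, the quotient of `L ⊗ L` by the relations
`r̄ m ⊗ n = m ⊗ r n`. -/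
abbrev Diamond : Type w := (L ⊗[k] L) ⧸ A.diamondRel

/-- The class in `L ◇ L` of a tensor. -/
def cls : L ⊗[k] L →ₗ[k] A.Diamond := A.diamondRel.mkQ

/-- The endomorphism `m ⊗ n ↦ m a ⊗ n b` of `L ◇ L`. -/
def diamondRight (a b : L) : A.Diamond →ₗ[k] A.Diamond :=
  Submodule.mapQ A.diamondRel A.diamondRel (TensorProduct.map (A.mul.flip a) (A.mul.flip b)) (by
    rw [diamondRel, Submodule.span_le]
    rintro _ ⟨r, m, n, rfl⟩
    refine Submodule.subset_span ⟨r, A.mul m a, A.mul n b, ?_⟩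
    simp [A.mul_assoc])

/-- `L ×_R L = ∫^s ∫_r (r̄ L s̄) ⊗ (r L s)`: the elements `∑ mᵢ ⊗ nᵢ` of `L ◇ L` with
`∑ mᵢ s̄ ⊗ nᵢ = ∑ mᵢ ⊗ nᵢ s` for all `s`. -/
def takeuchiProduct : Submodule k A.Diamond :=
  ⨅ s : R, LinearMap.ker (A.diamondRight (A.tgt s) A.one - A.diamondRight A.one (A.src s))

/-- The subspace of `L ⊗ L ⊗ L` spanned by all `r̄ m ⊗ p ⊗ n - m ⊗ r p ⊗ n` and
`m ⊗ t̄ p ⊗ n - m ⊗ p ⊗ t n`. -/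
def tripleRel : Submodule k (L ⊗[k] (L ⊗[k] L)) :=
  Submodule.span k
    ({z | ∃ (r : R) (m p n : L),
      z = A.mul (A.tgt r) m ⊗ₜ[k] (p ⊗ₜ[k] n) - m ⊗ₜ[k] (A.mul (A.src r) p ⊗ₜ[k] n)} ∪
    {z | ∃ (r : R) (m p n : L),
      z = m ⊗ₜ[k] (A.mul (A.tgt r) p ⊗ₜ[k] n) - m ⊗ₜ[k] (p ⊗ₜ[k] A.mul (A.src r) n)})

/-- `L ◇ L ◇ L = ∫_{r,t} (r̄ L) ⊗ (r, t̄ L) ⊗ (t L)`. -/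
abbrev Triple : Type w := (L ⊗[k] (L ⊗[k] L)) ⧸ A.tripleRel

/-- The map `(L ◇ L) × L → L ◇ L ◇ L`, `([m ⊗ p], n) ↦ [m ⊗ p ⊗ n]`. -/
def joinLeft : A.Diamond →ₗ[k] L →ₗ[k] A.Triple :=
  A.diamondRel.liftQ
    (LinearMap.compr₂ (TensorProduct.mk k (L ⊗[k] L) L)
      (A.tripleRel.mkQ ∘ₗ (TensorProduct.assoc k L L L).toLinearMap)) (by
    rw [diamondRel, Submodule.span_le]
    rintro _ ⟨r, m, p, rfl⟩
    simp only [SetLike.mem_coe, LinearMap.mem_ker]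
    ext n
    change A.tripleRel.mkQ (TensorProduct.assoc k L L L
      ((A.mul (A.tgt r) m ⊗ₜ[k] p - m ⊗ₜ[k] A.mul (A.src r) p) ⊗ₜ[k] n)) = 0
    rw [TensorProduct.sub_tmul, map_sub, TensorProduct.assoc_tmul, TensorProduct.assoc_tmul,
      Submodule.mkQ_apply, Submodule.Quotient.mk_eq_zero]
    exact Submodule.subset_span (Or.inl ⟨r, m, p, n, rfl⟩))

/-- The map `L × (L ◇ L) → L ◇ L ◇ L`, `(m, [p ⊗ n]) ↦ [m ⊗ p ⊗ n]`. -/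
def joinRight : A.Diamond →ₗ[k] L →ₗ[k] A.Triple :=
  A.diamondRel.liftQ
    (LinearMap.compr₂ (TensorProduct.mk k L (L ⊗[k] L)) A.tripleRel.mkQ).flip (by
    rw [diamondRel, Submodule.span_le]
    rintro _ ⟨r, p, n, rfl⟩
    simp only [SetLike.mem_coe, LinearMap.mem_ker]
    ext m
    simp only [LinearMap.flip_apply, LinearMap.compr₂_apply, TensorProduct.mk_apply,
      TensorProduct.tmul_sub, LinearMap.zero_apply]
    rw [Submodule.mkQ_apply, Submodule.Quotient.mk_eq_zero]
    exact Submodule.subset_span (Or.inr ⟨r, m, p, n, rfl⟩))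

/-- `Hom_{R̄}(L, R)`: the `k`-linear maps `ξ : L → R` with `ξ(r̄ h) = ξ(h) r`, i.e. the maps of
left `R̄`-modules, where `r̄` acts on `R` as right multiplication by `r`. -/
def leftDual : Submodule k (L →ₗ[k] R) where
  carrier := {ξ | ∀ (r : R) (h : L), ξ (A.mul (A.tgt r) h) = ξ h * r}
  add_mem' := by
    intro a b ha hb r h
    simp only [LinearMap.add_apply, ha r h, hb r h, add_mul]
  zero_mem' := by intro r h; simp
  smul_mem' := by
    intro c a ha r h
    simp only [LinearMap.smul_apply, ha r h, smul_mul_assoc]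

end EnvRing

/-- A `×_R`-bialgebra structure on the `k`-vector space `L`: an `Rᵉ`-ring `L` with a coassociative
comultiplication `Γ : L → L ×_R L` and a counit `C : L → End(R)` which are maps of `Rᵉ`-rings.
Conditions on `Γ` are evaluated on tensors `x : L ⊗ L` that represent `Γ(ℓ)`, in Sweedler notation
`x = ℓ₍₁₎ ⊗ ℓ₍₂₎`; the resulting elements do not depend on the representative. -/
structure TakeuchiBialgebra (k : Type u) (R : Type v) (L : Type w) [Field k] [Ring R] [Algebra k R]
    [AddCommGroup L] [Module k L] extends EnvRing k R L where
  Γ : L →ₗ[k] toEnvRing.Diamond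
  Γ_mem : ∀ l : L, Γ l ∈ toEnvRing.takeuchiProduct
  Γ_mul : ∀ (g h : L) (x y : L ⊗[k] L), toEnvRing.cls x = Γ g → toEnvRing.cls y = Γ h →
    Γ (mul g h) = toEnvRing.cls (toEnvRing.tmul x y)
  Γ_env : ∀ r s : R, Γ (η (r ⊗ₜ[k] MulOpposite.op s)) =
    toEnvRing.cls (toEnvRing.src r ⊗ₜ[k] toEnvRing.tgt s)
  C : L →ₗ[k] Module.End k R
  C_mul : ∀ g h : L, C (mul g h) = C g * C h
  C_env : ∀ r s t : R, C (η (r ⊗ₜ[k] MulOpposite.op s)) t = r * t * s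
  -- `(ℓ₍₁₎)₍₁₎ ⊗ (ℓ₍₁₎)₍₂₎ ⊗ ℓ₍₂₎ = ℓ₍₁₎ ⊗ (ℓ₍₂₎)₍₁₎ ⊗ (ℓ₍₂₎)₍₂₎`
  coassoc : ∀ (l : L) (x : L ⊗[k] L), toEnvRing.cls x = Γ l →
    TensorProduct.lift (toEnvRing.joinLeft ∘ₗ Γ) x =
      TensorProduct.lift (toEnvRing.joinRight ∘ₗ Γ).flip x
  -- `C(ℓ₍₂₎)(1)‾ ℓ₍₁₎ = ℓ`
  counit_right : ∀ (l : L) (x : L ⊗[k] L), toEnvRing.cls x = Γ l →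
    TensorProduct.lift (mul ∘ₗ toEnvRing.tgt ∘ₗ C.flip 1).flip x = l
  -- `C(ℓ₍₁₎)(1) ℓ₍₂₎ = ℓ`
  counit_left : ∀ (l : L) (x : L ⊗[k] L), toEnvRing.cls x = Γ l →
    TensorProduct.lift (mul ∘ₗ toEnvRing.src ∘ₗ C.flip 1) x = l

/-- A skew pairing `τ(ξ|h)` between the `×_R`-bialgebras `Λ` and `H`. -/
structure IsSkewPairing {k : Type u} {R : Type v} {Λ H : Type*} [Field k] [Ring R] [Algebra k R]
    [AddCommGroup Λ] [Module k Λ] [AddCommGroup H] [Module k H]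
    (BΛ : TakeuchiBialgebra k R Λ) (BH : TakeuchiBialgebra k R H)
    (τ : Λ →ₗ[k] H →ₗ[k] R) : Prop where
  -- `τ((r ⊗ s̄) ξ (t ⊗ ū) | h) v = r τ(ξ | (t ⊗ v̄) h (u ⊗ s̄))`
  bimod : ∀ (r s t u v : R) (ξ : Λ) (h : H),
    τ (BΛ.mul (BΛ.mul (BΛ.η (r ⊗ₜ[k] MulOpposite.op s)) ξ)
        (BΛ.η (t ⊗ₜ[k] MulOpposite.op u))) h * v =
      r * τ ξ (BH.mul (BH.mul (BH.η (t ⊗ₜ[k] MulOpposite.op v)) h)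
        (BH.η (u ⊗ₜ[k] MulOpposite.op s)))
  -- `τ(ξ|gh) = τ(τ(ξ₍₂₎|h)‾ ξ₍₁₎ | g)`
  mul_right : ∀ (ξ : Λ) (g h : H) (x : Λ ⊗[k] Λ), BΛ.cls x = BΛ.Γ ξ →
    τ ξ (BH.mul g h) = τ (TensorProduct.lift (BΛ.mul ∘ₗ BΛ.tgt ∘ₗ τ.flip h).flip x) g
  one_right : ∀ ξ : Λ, τ ξ BH.one = BΛ.C ξ 1
  -- `τ(ξζ|g) = τ(ξ | τ(ζ|g₍₁₎) g₍₂₎)`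
  mul_left : ∀ (ξ ζ : Λ) (g : H) (x : H ⊗[k] H), BH.cls x = BH.Γ g →
    τ (BΛ.mul ξ ζ) g = τ ξ (TensorProduct.lift (BH.mul ∘ₗ BH.src ∘ₗ τ ζ) x)
  one_left : ∀ h : H, τ BΛ.one h = BH.C h 1

/-- The structure maps of a weak bialgebra on the `k`-vector space `V`. -/
structure WeakBialgebraData (k : Type u) (V : Type w) [Field k] [AddCommGroup V] [Module k V] where
  mul : V →ₗ[k] V →ₗ[k] V
  one : V
  comul : V →ₗ[k] V ⊗[k] V
  counit : V →ₗ[k] k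

namespace WeakBialgebraData

variable {k : Type u} {V : Type w} [Field k] [AddCommGroup V] [Module k V]

/-- The axioms of a weak bialgebra: an algebra and coalgebra with multiplicative comultiplication,
weakly multiplicative counit and weakly comultiplicative unit. -/
structure IsWeakBialgebra (W : WeakBialgebraData k V) : Prop where
  mul_assoc : ∀ a b c : V, W.mul (W.mul a b) c = W.mul a (W.mul b c)
  one_mul : ∀ a : V, W.mul W.one a = a
  mul_one : ∀ a : V, W.mul a W.one = a
  coassoc : ∀ a : V,
    TensorProduct.assoc k V V V (TensorProduct.map W.comul LinearMap.id (W.comul a)) =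
      TensorProduct.map LinearMap.id W.comul (W.comul a)
  counit_left : ∀ a : V,
    TensorProduct.lid k V (TensorProduct.map W.counit LinearMap.id (W.comul a)) = a
  counit_right : ∀ a : V,
    TensorProduct.rid k V (TensorProduct.map LinearMap.id W.counit (W.comul a)) = a
  comul_mul : ∀ a b : V,
    W.comul (W.mul a b) = TensorProduct.map₂ W.mul W.mul (W.comul a) (W.comul b)
  -- `ε(fgh) = ε(f g₍₁₎) ε(g₍₂₎ h)`
  counit_mul : ∀ f g h : V, W.counit (W.mul (W.mul f g) h) =
    LinearMap.mul' k k (TensorProduct.map (W.counit ∘ₗ W.mul f) (W.counit ∘ₗ W.mul.flip h)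
      (W.comul g))
  -- `ε(fgh) = ε(f g₍₂₎) ε(g₍₁₎ h)`
  counit_mul_flip : ∀ f g h : V, W.counit (W.mul (W.mul f g) h) =
    LinearMap.mul' k k (TensorProduct.map (W.counit ∘ₗ W.mul.flip h) (W.counit ∘ₗ W.mul f)
      (W.comul g))
  -- `1₍₁₎ ⊗ 1₍₂₎ ⊗ 1₍₃₎ = (Δ(1) ⊗ 1)(1 ⊗ Δ(1))`
  comul_one : TensorProduct.map LinearMap.id W.comul (W.comul W.one) =
    TensorProduct.map₂ W.mul (TensorProduct.map₂ W.mul W.mul)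
      (TensorProduct.assoc k V V V (W.comul W.one ⊗ₜ[k] W.one)) (W.one ⊗ₜ[k] W.comul W.one)
  -- `1₍₁₎ ⊗ 1₍₂₎ ⊗ 1₍₃₎ = (1 ⊗ Δ(1))(Δ(1) ⊗ 1)`
  comul_one_flip : TensorProduct.map LinearMap.id W.comul (W.comul W.one) =
    TensorProduct.map₂ W.mul (TensorProduct.map₂ W.mul W.mul)
      (W.one ⊗ₜ[k] W.comul W.one) (TensorProduct.assoc k V V V (W.comul W.one ⊗ₜ[k] W.one))

/-- The opposite: the multiplication is reversed, everything else is kept. -/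
def op (W : WeakBialgebraData k V) : WeakBialgebraData k V where
  mul := W.mul.flip
  one := W.one
  comul := W.comul
  counit := W.counit

/-- The dual on `V* = Hom_k(V, k)`, for `V` finite-dimensional: the convolution product
`(f g)(v) = f(v₍₁₎) g(v₍₂₎)` with unit `ε`, the comultiplication determined by
`f₍₁₎(v) f₍₂₎(w) = f(v w)`, and the counit `f ↦ f(1)`. -/
def dual [FiniteDimensional k V] (W : WeakBialgebraData k V) :
    WeakBialgebraData k (Module.Dual k V) where
  mul := LinearMap.compr₂ (TensorProduct.mk k (Module.Dual k V) (Module.Dual k V))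
    (W.comul.dualMap ∘ₗ TensorProduct.dualDistrib k V V)
  one := W.counit
  comul := (TensorProduct.dualDistribEquiv k V V).symm.toLinearMap ∘ₗ
    (TensorProduct.lift W.mul).dualMap
  counit := Module.Dual.eval k V W.one

/-- A `k`-linear bijection `Φ` is an isomorphism of weak bialgebras. -/
structure IsIso {V' : Type*} [AddCommGroup V'] [Module k V'] (W : WeakBialgebraData k V)
    (W' : WeakBialgebraData k V') (Φ : V ≃ₗ[k] V') : Prop where
  map_mul : ∀ a b : V, Φ (W.mul a b) = W'.mul (Φ a) (Φ b)
  map_one : Φ W.one = W'.one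
  map_comul : ∀ a : V,
    TensorProduct.map Φ.toLinearMap Φ.toLinearMap (W.comul a) = W'.comul (Φ a)
  map_counit : ∀ a : V, W'.counit (Φ a) = W.counit a

end WeakBialgebraData

namespace TakeuchiBialgebra

variable {k : Type u} {R : Type v} {L : Type w} [Field k] [Ring R] [Algebra k R]
  [AddCommGroup L] [Module k L]

/-- The map `L ◇ L → L ⊗ L`, `[g ⊗ h] ↦ e̅¹ g ⊗ e² h`, for an idempotent Frobenius
system `(φ, e)`. -/
def split (B : TakeuchiBialgebra k R L) (F : IdempotentFrobeniusSystem k R) :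
    B.Diamond →ₗ[k] L ⊗[k] L :=
  B.diamondRel.liftQ (B.tmul (TensorProduct.map B.tgt B.src F.e)) (by
    have htgt : ∀ a b : R, B.mul (B.tgt a) (B.tgt b) = B.tgt (b * a) := by
      intro a b
      simp [EnvRing.tgt, ← B.η_mul]
    have hsrc : ∀ a b : R, B.mul (B.src a) (B.src b) = B.src (a * b) := by
      intro a b
      simp [EnvRing.src, ← B.η_mul]
    rw [EnvRing.diamondRel, Submodule.span_le]
    rintro _ ⟨r, m, n, rfl⟩
    simp only [SetLike.mem_coe, LinearMap.mem_ker, map_sub]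
    have h1 : ∀ t : R ⊗[k] R,
        B.tmul (TensorProduct.map B.tgt B.src t) (B.mul (B.tgt r) m ⊗ₜ[k] n) =
          B.tmul (TensorProduct.map B.tgt B.src
            (TensorProduct.map (LinearMap.mulLeft k r) LinearMap.id t)) (m ⊗ₜ[k] n) := by
      intro t
      induction t with
      | zero => simp
      | tmul c d => simp [EnvRing.tmul, ← htgt, B.mul_assoc]
      | add p q hp hq => simp only [map_add, LinearMap.add_apply, hp, hq]
    have h2 : ∀ t : R ⊗[k] R,
        B.tmul (TensorProduct.map B.tgt B.src t) (m ⊗ₜ[k] B.mul (B.src r) n) =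
          B.tmul (TensorProduct.map B.tgt B.src
            (TensorProduct.map LinearMap.id (LinearMap.mulRight k r) t)) (m ⊗ₜ[k] n) := by
      intro t
      induction t with
      | zero => simp
      | tmul c d => simp [EnvRing.tmul, ← hsrc, B.mul_assoc]
      | add p q hp hq => simp only [map_add, LinearMap.add_apply, hp, hq]
    rw [h1, h2, F.casimir, sub_self])

/-- The weak bialgebra that corresponds to a `×_R`-bialgebra and an idempotent Frobenius system
`(φ, e)` of `R`: the same algebra, with `Δ(h) = e̅¹ h₍₁₎ ⊗ e² h₍₂₎` and `ε(h) = φ(C(h)(1))`. -/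
def toWeak (B : TakeuchiBialgebra k R L) (F : IdempotentFrobeniusSystem k R) :
    WeakBialgebraData k L where
  mul := B.mul
  one := B.one
  comul := B.split F ∘ₗ B.Γ
  counit := F.φ ∘ₗ B.C.flip 1

end TakeuchiBialgebra

end

/-! ### Frobenius systems and preliminaries on tensors -/

noncomputable section

universe u v w

/-! Write `E = e̅¹ ⊗ e²` in `L ⊗ L`. The Casimir identity gives `E(r̄ ⊗ 1) = E(1 ⊗ r)`, so left
multiplication by `E` kills the relations of `L ◇ L`; since `e¹e² = 1`, it is the identity modulo
them. Thus `L ◇ L` is a copy of the subspace `E(L ⊗ L)`, similarly for `L ◇ L ◇ L`, and each axiom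
stated in a quotient becomes an equation between tensors over `k` (`cls_eq_iff`, `triple_eq_iff`).
Moreover `φ` is nondegenerate, so equations in `R` can be tested by equations in `k`. These two
facts turn a `×_R`-bialgebra into a weak bialgebra (`toWeak_isWeakBialgebra`), and turn a weak
bialgebra with base algebra `R` back into a `×_R`-bialgebra (`IsWeakBialgebraOver.toTakeuchi`).

The axioms of a finite-dimensional weak bialgebra are self-dual, and they come in pairs that
reversing the multiplication interchanges; this settles `H*` and its opposite. Because `φ(ξ(h)r) =
φ(ξ(r̄h))`, the map `ξ ↦ φ ∘ ξ` is a bijection from `Hom_{R̄}(H, R)` to `H*`. The opposite dual,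
carried back along it, has base algebra `R`, embedded by sending `r ⊗ s̄` to `h ↦ r C(h)(s)`, and so
comes from a `×_R`-bialgebra.

Two computations compare the pairing over `R` with the one over `k`. By `pair₂_leftDual`, the skew
pairing axiom for `ξζ` says that the product is the reversed convolution product; by
`pair₂_idem_leftDual`, the axiom for `gh` says that the coproduct `Δ` is dual to the multiplication
of `H`. They show that the structure just built is a skew pairing, and conversely that every
structure for which evaluation is a skew pairing corresponds to the opposite dual. The latter fixes
the product, the unit and `Δ`, hence `Γ = cls ∘ Δ`; the axioms force `η` and `C` directly. In
particular the resulting `×_R`-bialgebra does not depend on `(φ, e)`, although its construction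
does. -/

/-- An idempotent Frobenius system, written as a finite sum `e = ∑ aᵢ ⊗ bᵢ`. -/
theorem IdempotentFrobeniusSystem.exists_sum {k : Type u} {R : Type v} [Field k] [Ring R]
    [Algebra k R] (F : IdempotentFrobeniusSystem k R) :
    ∃ S : Finset (R × R), F.e = ∑ i ∈ S, i.1 ⊗ₜ[k] i.2 ∧
      (∀ r, ∑ i ∈ S, F.φ (r * i.1) • i.2 = r) ∧ (∀ r, ∑ i ∈ S, F.φ (i.2 * r) • i.1 = r) ∧
      ∑ i ∈ S, i.1 * i.2 = 1 := by
  obtain ⟨S, hS⟩ := TensorProduct.exists_finset F.e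
  refine ⟨S, hS, fun r => ?_, fun r => ?_, ?_⟩
  · simpa [hS] using F.left_id r
  · simpa [hS] using F.right_id r
  · simpa [hS] using F.mul_e

/-- Nondegeneracy of `φ`: the expansion `a = e¹ φ(e² a)` recovers `a` from the scalars `φ(s a)`. The
right-hand version uses `a = φ(a e¹) e²`. -/
theorem IdempotentFrobeniusSystem.ext_left {k : Type u} {R : Type v} [Field k] [Ring R]
    [Algebra k R] (F : IdempotentFrobeniusSystem k R) {a b : R}
    (h : ∀ s, F.φ (s * a) = F.φ (s * b)) : a = b := by
  obtain ⟨S, -, -, h1, -⟩ := F.exists_sum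
  rw [← h1 a, ← h1 b]
  simp only [h]

theorem IdempotentFrobeniusSystem.ext_right {k : Type u} {R : Type v} [Field k] [Ring R]
    [Algebra k R] (F : IdempotentFrobeniusSystem k R) {a b : R}
    (h : ∀ s, F.φ (a * s) = F.φ (b * s)) : a = b := by
  obtain ⟨S, -, h1, -, -⟩ := F.exists_sum
  rw [← h1 a, ← h1 b]
  simp only [h]

theorem TensorProduct.map₂_assoc {k : Type u} {M N : Type*} [Field k] [AddCommGroup M] [Module k M]
    [AddCommGroup N] [Module k N] {f : M →ₗ[k] M →ₗ[k] M} {g : N →ₗ[k] N →ₗ[k] N}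
    (hf : ∀ a b c, f (f a b) c = f a (f b c)) (hg : ∀ a b c, g (g a b) c = g a (g b c))
    (x y z : M ⊗[k] N) :
    TensorProduct.map₂ f g (TensorProduct.map₂ f g x y) z =
      TensorProduct.map₂ f g x (TensorProduct.map₂ f g y z) := by
  induction x with
  | zero => simp
  | add p q hp hq => simp only [map_add, LinearMap.add_apply, hp, hq]
  | tmul a b =>
    induction y with
    | zero => simp
    | add p q hp hq => simp only [map_add, LinearMap.add_apply, hp, hq]
    | tmul c d =>
      induction z with
      | zero => simp
      | add p q hp hq => simp only [map_add, hp, hq]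
      | tmul e h => simp [hf, hg]

/-! ### The idempotent `E = e̅¹ ⊗ e²` and the quotients `L ◇ L`, `L ◇ L ◇ L` -/

namespace EnvRing

variable {k : Type u} {R : Type v} {L : Type w} [Field k] [Ring R] [Algebra k R]
  [AddCommGroup L] [Module k L] (A : EnvRing k R L) (F : IdempotentFrobeniusSystem k R)

theorem src_mul (a b : R) : A.mul (A.src a) (A.src b) = A.src (a * b) := by
  simp [src, ← A.η_mul]

theorem tgt_mul (a b : R) : A.mul (A.tgt a) (A.tgt b) = A.tgt (b * a) := by
  simp [tgt, ← A.η_mul]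

theorem src_one : A.src 1 = A.one := by simp [src, ← A.η_one, Algebra.TensorProduct.one_def]

theorem tgt_one : A.tgt 1 = A.one := by simp [tgt, ← A.η_one, Algebra.TensorProduct.one_def]

theorem src_mul_tgt (r s : R) :
    A.mul (A.src r) (A.tgt s) = A.η (r ⊗ₜ[k] MulOpposite.op s) := by
  simp [src, tgt, ← A.η_mul]

theorem tgt_mul_src (r s : R) :
    A.mul (A.tgt s) (A.src r) = A.mul (A.src r) (A.tgt s) := by
  simp [src, tgt, ← A.η_mul]

theorem src_src (a b : R) (x : L) :
    A.mul (A.src a) (A.mul (A.src b) x) = A.mul (A.src (a * b)) x := by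
  rw [← A.mul_assoc, src_mul]

theorem tgt_tgt (a b : R) (x : L) :
    A.mul (A.tgt a) (A.mul (A.tgt b) x) = A.mul (A.tgt (b * a)) x := by
  rw [← A.mul_assoc, tgt_mul]

theorem tgt_src (r s : R) (x : L) :
    A.mul (A.tgt s) (A.mul (A.src r) x) = A.mul (A.src r) (A.mul (A.tgt s) x) := by
  rw [← A.mul_assoc, tgt_mul_src, A.mul_assoc]

theorem tmul_tmul (a b c d : L) :
    A.tmul (a ⊗ₜ[k] b) (c ⊗ₜ[k] d) = A.mul a c ⊗ₜ[k] A.mul b d := rfl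

theorem tmul_assoc (x y z : L ⊗[k] L) : A.tmul (A.tmul x y) z = A.tmul x (A.tmul y z) :=
  TensorProduct.map₂_assoc A.mul_assoc A.mul_assoc x y z

theorem tmul_one (x : L ⊗[k] L) : A.tmul x (A.one ⊗ₜ[k] A.one) = x := by
  induction x with
  | zero => simp
  | add p q hp hq => simp only [map_add, LinearMap.add_apply, hp, hq]
  | tmul a b => simp [tmul_tmul, A.mul_one]

/-- The multiplication of `L ⊗ L ⊗ L`. -/
def tmul₃ : L ⊗[k] (L ⊗[k] L) →ₗ[k] L ⊗[k] (L ⊗[k] L) →ₗ[k] L ⊗[k] (L ⊗[k] L) :=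
  TensorProduct.map₂ A.mul A.tmul

theorem tmul₃_tmul (a c : L) (b d : L ⊗[k] L) :
    A.tmul₃ (a ⊗ₜ[k] b) (c ⊗ₜ[k] d) = A.mul a c ⊗ₜ[k] A.tmul b d := rfl

theorem tmul₃_assoc (x y z : L ⊗[k] (L ⊗[k] L)) :
    A.tmul₃ (A.tmul₃ x y) z = A.tmul₃ x (A.tmul₃ y z) :=
  TensorProduct.map₂_assoc A.mul_assoc A.tmul_assoc x y z

theorem assoc_tmul₃ (x y : L ⊗[k] L) (m n : L) :
    A.tmul₃ (TensorProduct.assoc k L L L (x ⊗ₜ[k] m)) (TensorProduct.assoc k L L L (y ⊗ₜ[k] n)) =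
      TensorProduct.assoc k L L L (A.tmul x y ⊗ₜ[k] A.mul m n) := by
  induction x with
  | zero => simp
  | add p q hp hq => simp only [TensorProduct.add_tmul, map_add, LinearMap.add_apply, hp, hq]
  | tmul a b =>
    induction y with
    | zero => simp
    | add p q hp hq => simp only [TensorProduct.add_tmul, map_add, hp, hq]
    | tmul c d => rfl

/-- The idempotent `e̅¹ ⊗ e²` of `L ⊗ L`. -/
def idem : L ⊗[k] L := TensorProduct.map A.tgt A.src F.e

/-- The Casimir property, moved into `L ⊗ L`: `r ↦ r̄` reverses products, so `e̅¹ r̄` is the bar of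
`r e¹`. -/
theorem idem_tgt (r : R) :
    A.tmul (A.idem F) (A.tgt r ⊗ₜ[k] A.one) = A.tmul (A.idem F) (A.one ⊗ₜ[k] A.src r) := by
  have h1 : ∀ t : R ⊗[k] R, A.tmul (TensorProduct.map A.tgt A.src t) (A.tgt r ⊗ₜ[k] A.one) =
      TensorProduct.map A.tgt A.src
        (TensorProduct.map (LinearMap.mulLeft k r) LinearMap.id t) := by
    intro t
    induction t with
    | zero => simp
    | tmul c d => simp [tmul_tmul, tgt_mul, A.mul_one]
    | add p q hp hq => simp only [map_add, LinearMap.add_apply, hp, hq]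
  have h2 : ∀ t : R ⊗[k] R, A.tmul (TensorProduct.map A.tgt A.src t) (A.one ⊗ₜ[k] A.src r) =
      TensorProduct.map A.tgt A.src
        (TensorProduct.map LinearMap.id (LinearMap.mulRight k r) t) := by
    intro t
    induction t with
    | zero => simp
    | tmul c d => simp [tmul_tmul, src_mul, A.mul_one]
    | add p q hp hq => simp only [map_add, LinearMap.add_apply, hp, hq]
  rw [idem, h1, h2, F.casimir]

theorem idem_tgt_mul (r : R) (m n : L) :
    A.tmul (A.idem F) (A.mul (A.tgt r) m ⊗ₜ[k] n) =
      A.tmul (A.idem F) (m ⊗ₜ[k] A.mul (A.src r) n) := by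
  have := congrArg (fun x => A.tmul x (m ⊗ₜ[k] n)) (A.idem_tgt F r)
  simpa only [tmul_assoc, tmul_tmul, A.one_mul] using this

theorem cls_tgt (r : R) (m n : L) :
    A.cls (A.mul (A.tgt r) m ⊗ₜ[k] n) = A.cls (m ⊗ₜ[k] A.mul (A.src r) n) := by
  rw [← sub_eq_zero, ← map_sub, cls, Submodule.mkQ_apply, Submodule.Quotient.mk_eq_zero]
  exact Submodule.subset_span ⟨r, m, n, rfl⟩

theorem idem_of_mem {x : L ⊗[k] L} (hx : x ∈ A.diamondRel) : A.tmul (A.idem F) x = 0 := by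
  have : A.diamondRel ≤ LinearMap.ker (A.tmul (A.idem F)) := by
    rw [diamondRel, Submodule.span_le]
    rintro _ ⟨r, m, n, rfl⟩
    simp [idem_tgt_mul]
  exact this hx

/-- Separability enters here: in the quotient, `e̅¹ m ⊗ e² n = m ⊗ e¹e² n = m ⊗ n`. -/
theorem cls_idem (x : L ⊗[k] L) : A.cls (A.tmul (A.idem F) x) = A.cls x := by
  obtain ⟨S, hS, -, -, h1⟩ := F.exists_sum
  induction x with
  | zero => simp
  | add p q hp hq => simp only [map_add, hp, hq]
  | tmul m n =>
    simp only [idem, hS, map_sum, LinearMap.sum_apply, TensorProduct.map_tmul, tmul_tmul, cls_tgt,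
      src_src]
    simp only [← map_sum, ← TensorProduct.tmul_sum, ← LinearMap.sum_apply, h1, src_one, A.one_mul]

/-- Left multiplication by `E` is a projection whose kernel is exactly the space of relations, so it
detects equality of classes. -/
theorem cls_eq_iff {x y : L ⊗[k] L} :
    A.cls x = A.cls y ↔ A.tmul (A.idem F) x = A.tmul (A.idem F) y := by
  constructor
  · intro h
    rw [← sub_eq_zero, ← map_sub, cls, Submodule.mkQ_apply, Submodule.Quotient.mk_eq_zero] at h
    rw [← sub_eq_zero, ← map_sub, A.idem_of_mem F h]
  · intro h
    rw [← A.cls_idem F x, h, cls_idem]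

/-- The idempotent `e̅¹ ⊗ e² f̅¹ ⊗ f²` of `L ⊗ L ⊗ L`, where `e = f`. -/
def idem₃ : L ⊗[k] (L ⊗[k] L) :=
  A.tmul₃ (TensorProduct.assoc k L L L (A.idem F ⊗ₜ[k] A.one)) (A.one ⊗ₜ[k] A.idem F)

/-- The two factors meet only in the middle leg, where one contributes elements of `R` and the other
elements of `R̄`; these commute. -/
theorem idem₃_flip : A.idem₃ F =
    A.tmul₃ (A.one ⊗ₜ[k] A.idem F) (TensorProduct.assoc k L L L (A.idem F ⊗ₜ[k] A.one)) := by
  have : ∀ t t' : R ⊗[k] R,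
      A.tmul₃ (TensorProduct.assoc k L L L (TensorProduct.map A.tgt A.src t ⊗ₜ[k] A.one))
        (A.one ⊗ₜ[k] TensorProduct.map A.tgt A.src t') =
      A.tmul₃ (A.one ⊗ₜ[k] TensorProduct.map A.tgt A.src t')
        (TensorProduct.assoc k L L L (TensorProduct.map A.tgt A.src t ⊗ₜ[k] A.one)) := by
    intro t t'
    induction t with
    | zero => simp
    | add p q hp hq => simp only [TensorProduct.add_tmul, map_add, LinearMap.add_apply, hp, hq]
    | tmul a b =>
      induction t' with
      | zero => simp
      | add p q hp hq => simp only [TensorProduct.tmul_add, map_add, LinearMap.add_apply, hp, hq]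
      | tmul c d =>
        simp [tmul₃_tmul, tmul_tmul, A.one_mul, A.mul_one, tgt_mul_src]
  exact this _ _

theorem triple_tgt_left (r : R) (m p n : L) :
    A.tripleRel.mkQ (A.mul (A.tgt r) m ⊗ₜ[k] (p ⊗ₜ[k] n)) =
      A.tripleRel.mkQ (m ⊗ₜ[k] (A.mul (A.src r) p ⊗ₜ[k] n)) := by
  rw [← sub_eq_zero, ← map_sub, Submodule.mkQ_apply, Submodule.Quotient.mk_eq_zero]
  exact Submodule.subset_span (Or.inl ⟨r, m, p, n, rfl⟩)

theorem triple_tgt_right (r : R) (m p n : L) :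
    A.tripleRel.mkQ (m ⊗ₜ[k] (A.mul (A.tgt r) p ⊗ₜ[k] n)) =
      A.tripleRel.mkQ (m ⊗ₜ[k] (p ⊗ₜ[k] A.mul (A.src r) n)) := by
  rw [← sub_eq_zero, ← map_sub, Submodule.mkQ_apply, Submodule.Quotient.mk_eq_zero]
  exact Submodule.subset_span (Or.inr ⟨r, m, p, n, rfl⟩)

theorem idem₃_of_mem {x : L ⊗[k] (L ⊗[k] L)} (hx : x ∈ A.tripleRel) :
    A.tmul₃ (A.idem₃ F) x = 0 := by
  have : A.tripleRel ≤ LinearMap.ker (A.tmul₃ (A.idem₃ F)) := by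
    rw [tripleRel, Submodule.span_le]
    rintro _ (⟨r, m, p, n, rfl⟩ | ⟨r, m, p, n, rfl⟩)
    -- For a relation between the first two legs, the order `(1 ⊗ E)(E ⊗ 1)` lets `E ⊗ 1` meet it
    -- first; for the last two legs the defining order does the same for `1 ⊗ E`.
    · rw [SetLike.mem_coe, LinearMap.mem_ker, map_sub, sub_eq_zero, idem₃_flip, tmul₃_assoc,
        tmul₃_assoc]
      congr 1
      change A.tmul₃ _ (TensorProduct.assoc k L L L ((A.mul (A.tgt r) m ⊗ₜ[k] p) ⊗ₜ[k] n)) =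
        A.tmul₃ _ (TensorProduct.assoc k L L L ((m ⊗ₜ[k] A.mul (A.src r) p) ⊗ₜ[k] n))
      rw [assoc_tmul₃, assoc_tmul₃, idem_tgt_mul]
    · rw [SetLike.mem_coe, LinearMap.mem_ker, map_sub, sub_eq_zero, idem₃, tmul₃_assoc,
        tmul₃_assoc]
      rw [tmul₃_tmul, tmul₃_tmul, idem_tgt_mul]
  exact this hx

theorem mkQ_idem₃ (x : L ⊗[k] (L ⊗[k] L)) :
    A.tripleRel.mkQ (A.tmul₃ (A.idem₃ F) x) = A.tripleRel.mkQ x := by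
  obtain ⟨S, hS, -, -, h1⟩ := F.exists_sum
  have hl : ∀ m p n : L, A.tripleRel.mkQ
      (A.tmul₃ (TensorProduct.assoc k L L L (A.idem F ⊗ₜ[k] A.one)) (m ⊗ₜ[k] (p ⊗ₜ[k] n))) =
      A.tripleRel.mkQ (m ⊗ₜ[k] (p ⊗ₜ[k] n)) := by
    intro m p n
    simp only [idem, hS, map_sum, LinearMap.sum_apply, TensorProduct.map_tmul,
      TensorProduct.sum_tmul, TensorProduct.assoc_tmul, tmul₃_tmul, tmul_tmul, triple_tgt_left,
      src_src, A.one_mul]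
    simp only [← map_sum, ← TensorProduct.tmul_sum, ← TensorProduct.sum_tmul,
      ← LinearMap.sum_apply, h1, src_one, A.one_mul]
  have hr : ∀ m p n : L, A.tripleRel.mkQ
      (A.tmul₃ (A.one ⊗ₜ[k] A.idem F) (m ⊗ₜ[k] (p ⊗ₜ[k] n))) =
      A.tripleRel.mkQ (m ⊗ₜ[k] (p ⊗ₜ[k] n)) := by
    intro m p n
    simp only [idem, hS, map_sum, LinearMap.sum_apply, TensorProduct.map_tmul,
      TensorProduct.tmul_sum, tmul₃_tmul, tmul_tmul, triple_tgt_right,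
      src_src, A.one_mul]
    simp only [← map_sum, ← TensorProduct.tmul_sum, ← LinearMap.sum_apply, h1, src_one, A.one_mul]
  have hl' : ∀ x, A.tripleRel.mkQ
      (A.tmul₃ (TensorProduct.assoc k L L L (A.idem F ⊗ₜ[k] A.one)) x) = A.tripleRel.mkQ x := by
    intro x
    exact LinearMap.congr_fun (f := A.tripleRel.mkQ ∘ₗ
      A.tmul₃ (TensorProduct.assoc k L L L (A.idem F ⊗ₜ[k] A.one))) (g := A.tripleRel.mkQ)
      (TensorProduct.ext (LinearMap.ext fun m => TensorProduct.ext (LinearMap.ext fun p =>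
        LinearMap.ext fun n => hl m p n))) x
  have hr' : ∀ x, A.tripleRel.mkQ (A.tmul₃ (A.one ⊗ₜ[k] A.idem F) x) = A.tripleRel.mkQ x := by
    intro x
    exact LinearMap.congr_fun (f := A.tripleRel.mkQ ∘ₗ
      A.tmul₃ (A.one ⊗ₜ[k] A.idem F)) (g := A.tripleRel.mkQ)
      (TensorProduct.ext (LinearMap.ext fun m => TensorProduct.ext (LinearMap.ext fun p =>
        LinearMap.ext fun n => hr m p n))) x
  rw [idem₃, tmul₃_assoc, hl', hr']

/-- As for `L ◇ L`: `E₃ = idem₃` kills the relations and acts as the identity modulo them. -/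
theorem triple_eq_iff {x y : L ⊗[k] (L ⊗[k] L)} :
    A.tripleRel.mkQ x = A.tripleRel.mkQ y ↔ A.tmul₃ (A.idem₃ F) x = A.tmul₃ (A.idem₃ F) y := by
  constructor
  · intro h
    rw [← sub_eq_zero, ← map_sub, Submodule.mkQ_apply, Submodule.Quotient.mk_eq_zero] at h
    rw [← sub_eq_zero, ← map_sub, A.idem₃_of_mem F h]
  · intro h
    rw [← A.mkQ_idem₃ F x, h, mkQ_idem₃]

theorem lift_joinLeft (Δ : L →ₗ[k] L ⊗[k] L) (x : L ⊗[k] L) :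
    TensorProduct.lift (A.joinLeft ∘ₗ A.cls ∘ₗ Δ) x =
      A.tripleRel.mkQ (TensorProduct.assoc k L L L (TensorProduct.map Δ LinearMap.id x)) := by
  induction x with
  | zero => simp
  | add p q hp hq => simp only [map_add, hp, hq]
  | tmul a b => rfl

theorem lift_joinRight (Δ : L →ₗ[k] L ⊗[k] L) (x : L ⊗[k] L) :
    TensorProduct.lift (A.joinRight ∘ₗ A.cls ∘ₗ Δ).flip x =
      A.tripleRel.mkQ (TensorProduct.map LinearMap.id Δ x) := by
  induction x with
  | zero => simp
  | add p q hp hq => simp only [map_add, hp, hq]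
  | tmul a b => rfl

/-- By `φ(c(m) e¹) e² = c(m)`, applying `ε` to the first leg of `E(m ⊗ n)` gives `c(m) n`. With `c =
C(-)(1)` this identifies the counit axiom over `k` with the one over `R`; it is used in both
directions. -/
theorem lid_counit_idem {ε : L →ₗ[k] k} {c : L →ₗ[k] R}
    (hc : ∀ a m, ε (A.mul (A.tgt a) m) = F.φ (c m * a)) (x : L ⊗[k] L) : TensorProduct.lid k L
    (TensorProduct.map ε LinearMap.id (A.tmul (A.idem F) x)) =
      TensorProduct.lift (A.mul ∘ₗ A.src ∘ₗ c) x := by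
  obtain ⟨S, hS, h1, -, -⟩ := F.exists_sum
  induction x with
  | zero => simp
  | add p q hp hq => simp only [map_add, hp, hq]
  | tmul m n =>
    simp only [EnvRing.idem, hS, map_sum, LinearMap.sum_apply, TensorProduct.map_tmul,
      EnvRing.tmul_tmul, hc, TensorProduct.lid_tmul, LinearMap.id_apply,
      TensorProduct.lift.tmul, LinearMap.comp_apply]
    conv_rhs => rw [← h1 (c m)]
    simp only [map_sum, map_smul, LinearMap.sum_apply, LinearMap.smul_apply]

theorem rid_counit_idem {ε : L →ₗ[k] k} {c : L →ₗ[k] R}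
    (hc : ∀ a m, ε (A.mul (A.src a) m) = F.φ (a * c m)) (x : L ⊗[k] L) : TensorProduct.rid k L
    (TensorProduct.map LinearMap.id ε (A.tmul (A.idem F) x)) =
      TensorProduct.lift (A.mul ∘ₗ A.tgt ∘ₗ c).flip x := by
  obtain ⟨S, hS, -, h1, -⟩ := F.exists_sum
  induction x with
  | zero => simp
  | add p q hp hq => simp only [map_add, hp, hq]
  | tmul m n =>
    simp only [EnvRing.idem, hS, map_sum, LinearMap.sum_apply, TensorProduct.map_tmul,
      EnvRing.tmul_tmul, hc, TensorProduct.rid_tmul, LinearMap.id_apply,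
      TensorProduct.lift.tmul, LinearMap.comp_apply, LinearMap.flip_apply]
    conv_rhs => rw [← h1 (c n)]
    simp only [map_sum, map_smul, LinearMap.sum_apply, LinearMap.smul_apply]

theorem diamondRight_cls (a b : L) (x : L ⊗[k] L) :
    A.diamondRight a b (A.cls x) = A.cls (A.tmul x (a ⊗ₜ[k] b)) := by
  induction x with
  | zero => simp
  | add p q hp hq => simp only [map_add, LinearMap.add_apply, hp, hq]
  | tmul m n => rfl

/-! ### Multiplicative comultiplications with `Δ(r ⊗ s̄) = E(r ⊗ s̄)` -/

section Comul

variable {A F} {Δ : L →ₗ[k] L ⊗[k] L}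
  (hmul : ∀ a b, Δ (A.mul a b) = A.tmul (Δ a) (Δ b))
  (henv : ∀ r s : R, Δ (A.η (r ⊗ₜ[k] MulOpposite.op s)) =
    A.tmul (A.idem F) (A.src r ⊗ₜ[k] A.tgt s))

include henv

theorem comul_src (r : R) : Δ (A.src r) = A.tmul (A.idem F) (A.src r ⊗ₜ[k] A.one) := by
  have := henv r 1
  rwa [← src_mul_tgt, tgt_one, A.mul_one] at this

theorem comul_tgt (s : R) : Δ (A.tgt s) = A.tmul (A.idem F) (A.one ⊗ₜ[k] A.tgt s) := by
  have := henv 1 s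
  rwa [← src_mul_tgt, src_one, A.one_mul] at this

theorem comul_one : Δ A.one = A.idem F := by
  rw [← tgt_one, comul_tgt henv, tgt_one, tmul_one]

theorem comul_left_idem : TensorProduct.assoc k L L L
    (TensorProduct.map Δ LinearMap.id (A.idem F)) = A.idem₃ F := by
  have : ∀ t : R ⊗[k] R, TensorProduct.assoc k L L L
      (TensorProduct.map Δ LinearMap.id (TensorProduct.map A.tgt A.src t)) =
      A.tmul₃ (TensorProduct.assoc k L L L (A.idem F ⊗ₜ[k] A.one))
        (A.one ⊗ₜ[k] TensorProduct.map A.tgt A.src t) := by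
    intro t
    induction t with
    | zero => simp
    | add p q hp hq => simp only [map_add, hp, hq, TensorProduct.tmul_add]
    | tmul a b =>
      rw [TensorProduct.map_tmul, TensorProduct.map_tmul, comul_tgt henv]
      change _ = A.tmul₃ _ (TensorProduct.assoc k L L L ((A.one ⊗ₜ[k] A.tgt a) ⊗ₜ[k] A.src b))
      rw [assoc_tmul₃, A.one_mul, LinearMap.id_apply]
  exact this _

theorem comul_right_idem :
    TensorProduct.map LinearMap.id Δ (A.idem F) = A.idem₃ F := by
  have : ∀ t : R ⊗[k] R,
      TensorProduct.map LinearMap.id Δ (TensorProduct.map A.tgt A.src t) =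
      A.tmul₃ (A.one ⊗ₜ[k] A.idem F)
        (TensorProduct.assoc k L L L (TensorProduct.map A.tgt A.src t ⊗ₜ[k] A.one)) := by
    intro t
    induction t with
    | zero => simp
    | add p q hp hq => simp only [map_add, hp, hq, TensorProduct.add_tmul]
    | tmul a b =>
      rw [TensorProduct.map_tmul, TensorProduct.map_tmul, comul_src henv,
        TensorProduct.assoc_tmul, tmul₃_tmul, A.one_mul, LinearMap.id_apply]
  rw [idem₃_flip]
  exact this _

include hmul

/-- Multiplicativity together with `(Δ ⊗ id)(E) = E₃`. With its mirror image and `triple_eq_iff`, it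
shows that coassociativity in the quotient, evaluated at a representative `x`, is coassociativity
over `k` evaluated at `E x`. -/
theorem comul_left_idem_mul (x : L ⊗[k] L) : TensorProduct.assoc k L L L
    (TensorProduct.map Δ LinearMap.id (A.tmul (A.idem F) x)) =
      A.tmul₃ (A.idem₃ F) (TensorProduct.assoc k L L L (TensorProduct.map Δ LinearMap.id x)) := by
  rw [← comul_left_idem henv]
  generalize A.idem F = y
  induction x with
  | zero => simp
  | add p q hp hq => simp only [map_add, hp, hq]
  | tmul a b =>
    induction y with
    | zero => simp
    | add p q hp hq => simp only [map_add, LinearMap.add_apply, hp, hq]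
    | tmul c d =>
      simp only [tmul_tmul, TensorProduct.map_tmul, hmul, assoc_tmul₃, LinearMap.id_apply]

theorem comul_right_idem_mul (x : L ⊗[k] L) :
    TensorProduct.map LinearMap.id Δ (A.tmul (A.idem F) x) =
      A.tmul₃ (A.idem₃ F) (TensorProduct.map LinearMap.id Δ x) := by
  rw [← comul_right_idem henv]
  generalize A.idem F = y
  induction x with
  | zero => simp
  | add p q hp hq => simp only [map_add, hp, hq]
  | tmul a b =>
    induction y with
    | zero => simp
    | add p q hp hq => simp only [map_add, LinearMap.add_apply, hp, hq]
    | tmul c d =>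
      simp only [tmul_tmul, TensorProduct.map_tmul, hmul, tmul₃_tmul, LinearMap.id_apply]

end Comul

end EnvRing

/-! ### From `×_R`-bialgebras to weak bialgebras -/

namespace TakeuchiBialgebra

variable {k : Type u} {R : Type v} {L : Type w} [Field k] [Ring R] [Algebra k R]
  [AddCommGroup L] [Module k L] (B : TakeuchiBialgebra k R L) (F : IdempotentFrobeniusSystem k R)

theorem split_cls (x : L ⊗[k] L) : B.split F (B.cls x) = B.tmul (B.idem F) x := rfl

theorem toWeak_comul_eq {x : L ⊗[k] L} {l : L} (hx : B.cls x = B.Γ l) :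
    (B.toWeak F).comul l = B.tmul (B.idem F) x := by
  rw [← split_cls, hx]
  rfl

theorem cls_toWeak_comul (l : L) : B.cls ((B.toWeak F).comul l) = B.Γ l := by
  obtain ⟨x, hx⟩ := B.diamondRel.mkQ_surjective (B.Γ l)
  rw [B.toWeak_comul_eq F hx, B.cls_idem]
  exact hx

theorem Γ_eq : B.Γ = B.cls ∘ₗ (B.toWeak F).comul :=
  LinearMap.ext fun l => (B.cls_toWeak_comul F l).symm

/-- `Δ(l)` is itself a representative of `Γ(l)`, and multiplying any representative by `E` yields
`Δ(l)`. -/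
theorem idem_toWeak_comul (l : L) :
    B.tmul (B.idem F) ((B.toWeak F).comul l) = (B.toWeak F).comul l :=
  (B.toWeak_comul_eq F (B.cls_toWeak_comul F l)).symm

theorem toWeak_comul_mul (a b : L) : (B.toWeak F).comul (B.mul a b) =
    B.tmul ((B.toWeak F).comul a) ((B.toWeak F).comul b) := by
  have h : B.cls (B.tmul ((B.toWeak F).comul a) ((B.toWeak F).comul b)) = B.Γ (B.mul a b) :=
    (B.Γ_mul a b _ _ (B.cls_toWeak_comul F a) (B.cls_toWeak_comul F b)).symm
  rw [B.toWeak_comul_eq F h, ← B.tmul_assoc, idem_toWeak_comul]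

theorem toWeak_comul_env (r s : R) :
    (B.toWeak F).comul (B.η (r ⊗ₜ[k] MulOpposite.op s)) =
      B.tmul (B.idem F) (B.src r ⊗ₜ[k] B.tgt s) :=
  B.toWeak_comul_eq F (B.Γ_env r s).symm

theorem toWeak_comul_mul_idem (a : L) :
    B.tmul ((B.toWeak F).comul a) (B.idem F) = (B.toWeak F).comul a := by
  have := B.toWeak_comul_mul F a B.one
  rwa [EnvRing.comul_one (B.toWeak_comul_env F), B.mul_one, eq_comm] at this

theorem toWeak_comul_mul_src (a : L) (r : R) : (B.toWeak F).comul (B.mul a (B.src r)) =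
    B.tmul ((B.toWeak F).comul a) (B.src r ⊗ₜ[k] B.one) := by
  rw [toWeak_comul_mul, EnvRing.comul_src (B.toWeak_comul_env F), ← B.tmul_assoc,
    toWeak_comul_mul_idem]

theorem toWeak_comul_mul_tgt (a : L) (r : R) : (B.toWeak F).comul (B.mul a (B.tgt r)) =
    B.tmul ((B.toWeak F).comul a) (B.one ⊗ₜ[k] B.tgt r) := by
  rw [toWeak_comul_mul, EnvRing.comul_tgt (B.toWeak_comul_env F), ← B.tmul_assoc,
    toWeak_comul_mul_idem]

theorem C_src (r t : R) : B.C (B.src r) t = r * t := by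
  have := B.C_env r 1 t
  rwa [← B.src_mul_tgt, B.tgt_one, B.mul_one, mul_one] at this

theorem C_tgt (s t : R) : B.C (B.tgt s) t = t * s := by
  have := B.C_env 1 s t
  rwa [← B.src_mul_tgt, B.src_one, B.one_mul, one_mul] at this

theorem C_mul_src (l : L) (r t : R) : B.C (B.mul l (B.src r)) t = B.C l (r * t) := by
  rw [B.C_mul, Module.End.mul_apply, C_src]

theorem C_mul_tgt (l : L) (r t : R) : B.C (B.mul l (B.tgt r)) t = B.C l (t * r) := by
  rw [B.C_mul, Module.End.mul_apply, C_tgt]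

theorem C_src_mul (l : L) (r t : R) : B.C (B.mul (B.src r) l) t = r * B.C l t := by
  rw [B.C_mul, Module.End.mul_apply, C_src]

theorem C_tgt_mul (l : L) (r t : R) : B.C (B.mul (B.tgt r) l) t = B.C l t * r := by
  rw [B.C_mul, Module.End.mul_apply, C_tgt]

theorem toWeak_counit (l : L) : (B.toWeak F).counit l = F.φ (B.C l 1) := rfl

/-- `C(fh)(1) = C(f)(C(h)(1))` depends on `h` only through `C(h)(1)`, so `h` may be replaced by any
element with the same value. Both `C(h)(1)` and its bar qualify. -/
theorem toWeak_counit_mul_src (f h : L) :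
    (B.toWeak F).counit (B.mul f h) = (B.toWeak F).counit (B.mul f (B.src (B.C h 1))) := by
  simp only [toWeak_counit, C_mul_src, mul_one]
  rw [B.C_mul, Module.End.mul_apply]

theorem toWeak_counit_mul_tgt (f h : L) :
    (B.toWeak F).counit (B.mul f h) = (B.toWeak F).counit (B.mul f (B.tgt (B.C h 1))) := by
  simp only [toWeak_counit, C_mul_tgt, one_mul]
  rw [B.C_mul, Module.End.mul_apply]

theorem toWeak_counit_left (l : L) : TensorProduct.lid k L
    (TensorProduct.map (B.toWeak F).counit LinearMap.id ((B.toWeak F).comul l)) = l := by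
  rw [← idem_toWeak_comul, B.lid_counit_idem F (c := B.C.flip 1) (fun a m => by
    rw [toWeak_counit, C_tgt_mul]; rfl), B.counit_left l _ (B.cls_toWeak_comul F l)]

theorem toWeak_counit_right (l : L) : TensorProduct.rid k L
    (TensorProduct.map LinearMap.id (B.toWeak F).counit ((B.toWeak F).comul l)) = l := by
  rw [← idem_toWeak_comul, B.rid_counit_idem F (c := B.C.flip 1) (fun a m => by
    rw [toWeak_counit, C_src_mul]; rfl), B.counit_right l _ (B.cls_toWeak_comul F l)]

theorem toWeak_coassoc (l : L) : TensorProduct.assoc k L L L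
    (TensorProduct.map (B.toWeak F).comul LinearMap.id ((B.toWeak F).comul l)) =
      TensorProduct.map LinearMap.id (B.toWeak F).comul ((B.toWeak F).comul l) := by
  have h := B.coassoc l _ (B.cls_toWeak_comul F l)
  rw [B.Γ_eq F, B.lift_joinLeft, B.lift_joinRight, B.triple_eq_iff F,
    ← EnvRing.comul_left_idem_mul (B.toWeak_comul_mul F) (B.toWeak_comul_env F),
    ← EnvRing.comul_right_idem_mul (B.toWeak_comul_mul F) (B.toWeak_comul_env F),
    idem_toWeak_comul] at h
  exact h

theorem toWeak_isWeakBialgebra : (B.toWeak F).IsWeakBialgebra where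
  mul_assoc := B.mul_assoc
  one_mul := B.one_mul
  mul_one := B.mul_one
  coassoc := B.toWeak_coassoc F
  counit_left := B.toWeak_counit_left F
  counit_right := B.toWeak_counit_right F
  comul_mul := B.toWeak_comul_mul F
  counit_mul f g h := by
    -- In `ε(g₍₂₎ h)` replace `h` by `t̄` with `t = C(h)(1)`. Since `Δ(g)(1 ⊗ t̄) = Δ(g t̄)`, the
    -- counit axiom for `g t̄` finishes.
    have key : ∀ x : L ⊗[k] L, LinearMap.mul' k k
        (TensorProduct.map ((B.toWeak F).counit ∘ₗ B.mul f)
          ((B.toWeak F).counit ∘ₗ B.mul.flip h) x) =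
        (B.toWeak F).counit (B.mul f (TensorProduct.rid k L (TensorProduct.map LinearMap.id
          (B.toWeak F).counit (B.tmul x (B.one ⊗ₜ[k] B.tgt (B.C h 1)))))) := by
      intro x
      induction x with
      | zero => simp
      | add p q hp hq => simp only [map_add, LinearMap.add_apply, hp, hq]
      | tmul a b =>
        simp only [EnvRing.tmul_tmul, TensorProduct.map_tmul, LinearMap.mul'_apply,
          LinearMap.comp_apply, LinearMap.flip_apply, toWeak_counit_mul_tgt B F b h,
          TensorProduct.rid_tmul, B.mul_one, map_smul, LinearMap.id_apply, smul_eq_mul, mul_comm]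
    change (B.toWeak F).counit (B.mul (B.mul f g) h) = LinearMap.mul' k k
        (TensorProduct.map ((B.toWeak F).counit ∘ₗ B.mul f)
          ((B.toWeak F).counit ∘ₗ B.mul.flip h) ((B.toWeak F).comul g))
    rw [key, ← toWeak_comul_mul_tgt, toWeak_counit_right, toWeak_counit_mul_tgt, B.mul_assoc]
  counit_mul_flip f g h := by
    -- Now `h` multiplies the first leg, so it is replaced by `t = C(h)(1)` in `R`, because `Δ(g)(t
    -- ⊗ 1) = Δ(g t)`.
    have key : ∀ x : L ⊗[k] L, LinearMap.mul' k k
        (TensorProduct.map ((B.toWeak F).counit ∘ₗ B.mul.flip h)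
          ((B.toWeak F).counit ∘ₗ B.mul f) x) =
        (B.toWeak F).counit (B.mul f (TensorProduct.lid k L (TensorProduct.map
          (B.toWeak F).counit LinearMap.id (B.tmul x (B.src (B.C h 1) ⊗ₜ[k] B.one))))) := by
      intro x
      induction x with
      | zero => simp
      | add p q hp hq => simp only [map_add, LinearMap.add_apply, hp, hq]
      | tmul a b =>
        simp only [EnvRing.tmul_tmul, TensorProduct.map_tmul, LinearMap.mul'_apply,
          LinearMap.comp_apply, LinearMap.flip_apply, toWeak_counit_mul_src B F a h,
          TensorProduct.lid_tmul, B.mul_one, map_smul, LinearMap.id_apply, smul_eq_mul]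
    change (B.toWeak F).counit (B.mul (B.mul f g) h) = LinearMap.mul' k k
        (TensorProduct.map ((B.toWeak F).counit ∘ₗ B.mul.flip h)
          ((B.toWeak F).counit ∘ₗ B.mul f) ((B.toWeak F).comul g))
    rw [key, ← toWeak_comul_mul_src, toWeak_counit_left, toWeak_counit_mul_src, B.mul_assoc]
  comul_one := by
    change TensorProduct.map LinearMap.id (B.toWeak F).comul ((B.toWeak F).comul B.one) =
      B.tmul₃ (TensorProduct.assoc k L L L ((B.toWeak F).comul B.one ⊗ₜ[k] B.one))
        (B.one ⊗ₜ[k] (B.toWeak F).comul B.one)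
    rw [EnvRing.comul_one (B.toWeak_comul_env F),
      EnvRing.comul_right_idem (B.toWeak_comul_env F)]
    rfl
  comul_one_flip := by
    change TensorProduct.map LinearMap.id (B.toWeak F).comul ((B.toWeak F).comul B.one) =
      B.tmul₃ (B.one ⊗ₜ[k] (B.toWeak F).comul B.one)
        (TensorProduct.assoc k L L L ((B.toWeak F).comul B.one ⊗ₜ[k] B.one))
    rw [EnvRing.comul_one (B.toWeak_comul_env F),
      EnvRing.comul_right_idem (B.toWeak_comul_env F), B.idem₃_flip]

end TakeuchiBialgebra

/-! ### Opposites and duals of weak bialgebras -/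

namespace WeakBialgebraData

variable {k : Type u} {V V' : Type*} [Field k] [AddCommGroup V] [Module k V]
  [AddCommGroup V'] [Module k V']

/-- Reversing the multiplication interchanges the two axioms for `ε(fgh)` and the two axioms for
`Δ(1)`. -/
theorem IsWeakBialgebra.op {W : WeakBialgebraData k V} (hW : W.IsWeakBialgebra) :
    W.op.IsWeakBialgebra := by
  have hflip : ∀ x y : V ⊗[k] V, TensorProduct.map₂ W.mul.flip W.mul.flip x y =
      TensorProduct.map₂ W.mul W.mul y x := by
    intro x y
    induction x with
    | zero => simp
    | add p q hp hq => simp only [map_add, LinearMap.add_apply, hp, hq]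
    | tmul a b =>
      induction y with
      | zero => simp
      | add p q hp hq => simp only [map_add, LinearMap.add_apply, hp, hq]
      | tmul c d => simp
  have hflip₃ : ∀ x y : V ⊗[k] (V ⊗[k] V),
      TensorProduct.map₂ W.mul.flip (TensorProduct.map₂ W.mul.flip W.mul.flip) x y =
      TensorProduct.map₂ W.mul (TensorProduct.map₂ W.mul W.mul) y x := by
    intro x y
    induction x with
    | zero => simp
    | add p q hp hq => simp only [map_add, LinearMap.add_apply, hp, hq]
    | tmul a b =>
      induction y with
      | zero => simp
      | add p q hp hq => simp only [map_add, LinearMap.add_apply, hp, hq]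
      | tmul c d => simp [hflip]
  exact
  { mul_assoc := fun a b c => (hW.mul_assoc c b a).symm
    one_mul := hW.mul_one
    mul_one := hW.one_mul
    coassoc := hW.coassoc
    counit_left := hW.counit_left
    counit_right := hW.counit_right
    comul_mul := fun a b => (hW.comul_mul b a).trans (hflip _ _).symm
    counit_mul := fun f g h => by
      have := hW.counit_mul_flip h g f
      rw [hW.mul_assoc] at this
      exact this
    counit_mul_flip := fun f g h => by
      have := hW.counit_mul h g f
      rw [hW.mul_assoc] at this
      exact this
    comul_one := hW.comul_one_flip.trans (hflip₃ _ _).symm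
    comul_one_flip := hW.comul_one.trans (hflip₃ _ _).symm }

/-- The pairing of `V' ⊗ V'` with `V ⊗ V` induced by a pairing of `V'` with `V`. -/
def pair₂ (P : V' →ₗ[k] Module.Dual k V) : V' ⊗[k] V' →ₗ[k] Module.Dual k (V ⊗[k] V) :=
  TensorProduct.dualDistrib k V V ∘ₗ TensorProduct.map P P

/-- The pairing of `V' ⊗ V' ⊗ V'` with `V ⊗ V ⊗ V` induced by a pairing of `V'` with `V`. -/
def pair₃ (P : V' →ₗ[k] Module.Dual k V) :
    V' ⊗[k] (V' ⊗[k] V') →ₗ[k] Module.Dual k (V ⊗[k] (V ⊗[k] V)) :=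
  TensorProduct.dualDistrib k V (V ⊗[k] V) ∘ₗ TensorProduct.map P (pair₂ P)

@[simp]
theorem pair₂_tmul (P : V' →ₗ[k] Module.Dual k V) (f g : V') (v w : V) :
    pair₂ P (f ⊗ₜ[k] g) (v ⊗ₜ[k] w) = P f v * P g w := rfl

@[simp]
theorem pair₃_tmul (P : V' →ₗ[k] Module.Dual k V) (f : V') (g : V' ⊗[k] V') (v : V)
    (w : V ⊗[k] V) : pair₃ P (f ⊗ₜ[k] g) (v ⊗ₜ[k] w) = P f v * pair₂ P g w := rfl

theorem dualDistrib_injective {V U : Type*} [AddCommGroup V] [Module k V] [AddCommGroup U]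
    [Module k U] [FiniteDimensional k V] [FiniteDimensional k U] :
    Function.Injective (TensorProduct.dualDistrib k V U) :=
  (TensorProduct.dualDistribEquiv k V U).injective

theorem pair₂_injective [FiniteDimensional k V] (P : V' ≃ₗ[k] Module.Dual k V) :
    Function.Injective (pair₂ P.toLinearMap) :=
  dualDistrib_injective.comp (TensorProduct.congr P P).injective

theorem pair₃_injective [FiniteDimensional k V] (P : V' ≃ₗ[k] Module.Dual k V) :
    Function.Injective (pair₃ P.toLinearMap) :=
  dualDistrib_injective.comp (TensorProduct.congr P
    (TensorProduct.congr P P ≪≫ₗ TensorProduct.dualDistribEquiv k V V)).injective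

theorem pair₂_ext [FiniteDimensional k V] (P : V' ≃ₗ[k] Module.Dual k V) {x y : V' ⊗[k] V'}
    (h : ∀ v w, pair₂ P.toLinearMap x (v ⊗ₜ w) = pair₂ P.toLinearMap y (v ⊗ₜ w)) : x = y :=
  pair₂_injective P (TensorProduct.ext' h)

theorem pair₃_ext [FiniteDimensional k V] (P : V' ≃ₗ[k] Module.Dual k V)
    {x y : V' ⊗[k] (V' ⊗[k] V')}
    (h : ∀ u v w, pair₃ P.toLinearMap x (u ⊗ₜ (v ⊗ₜ w)) = pair₃ P.toLinearMap y (u ⊗ₜ (v ⊗ₜ w))) :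
    x = y :=
  pair₃_injective P (TensorProduct.ext (LinearMap.ext fun u =>
    TensorProduct.ext' fun v w => h u v w))

/-- `W'` is the dual of `W` by way of the pairing `P`. -/
structure IsDual (W : WeakBialgebraData k V) (W' : WeakBialgebraData k V')
    (P : V' →ₗ[k] Module.Dual k V) : Prop where
  mul : ∀ (f g : V') (v : V), P (W'.mul f g) v = pair₂ P (f ⊗ₜ[k] g) (W.comul v)
  one : ∀ v : V, P W'.one v = W.counit v
  comul : ∀ (f : V') (v w : V), pair₂ P (W'.comul f) (v ⊗ₜ[k] w) = P f (W.mul v w)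
  counit : ∀ f : V', W'.counit f = P f W.one

namespace IsDual

variable {W : WeakBialgebraData k V} {W' : WeakBialgebraData k V'} {P : V' →ₗ[k] Module.Dual k V}

theorem pair₃_comul_left (h : IsDual W W' P) (a b c : V') (x : V ⊗[k] V) :
    pair₃ P (a ⊗ₜ (b ⊗ₜ c))
      (TensorProduct.assoc k V V V (TensorProduct.map W.comul LinearMap.id x)) =
    pair₂ P (W'.mul a b ⊗ₜ c) x := by
  induction x with
  | zero => simp
  | add p q hp hq => simp only [map_add, hp, hq]
  | tmul v w =>
    rw [pair₂_tmul, h.mul, TensorProduct.map_tmul]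
    generalize W.comul v = y
    induction y with
    | zero => simp
    | add p q hp hq => simp only [map_add, TensorProduct.add_tmul, add_mul, hp, hq]
    | tmul s t => simp [mul_assoc]

theorem pair₃_comul_right (h : IsDual W W' P) (a b c : V') (x : V ⊗[k] V) :
    pair₃ P (a ⊗ₜ (b ⊗ₜ c)) (TensorProduct.map LinearMap.id W.comul x) =
    pair₂ P (a ⊗ₜ W'.mul b c) x := by
  induction x with
  | zero => simp
  | add p q hp hq => simp only [map_add, hp, hq]
  | tmul v w => rw [pair₂_tmul, h.mul, TensorProduct.map_tmul, pair₃_tmul, LinearMap.id_apply]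

theorem pair₃_assoc (P : V' →ₗ[k] Module.Dual k V) (x : V' ⊗[k] V') (f : V') (u v w : V) :
    pair₃ P (TensorProduct.assoc k V' V' V' (x ⊗ₜ f)) (u ⊗ₜ (v ⊗ₜ w)) =
      pair₂ P x (u ⊗ₜ v) * P f w := by
  induction x with
  | zero => simp
  | add p q hp hq =>
    simp only [map_add, TensorProduct.add_tmul, LinearMap.add_apply, add_mul, hp, hq]
  | tmul s t => simp [mul_assoc]

theorem pair₃_dual_comul_left (h : IsDual W W' P) (x : V' ⊗[k] V') (u v w : V) :
    pair₃ P (TensorProduct.assoc k V' V' V' (TensorProduct.map W'.comul LinearMap.id x))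
      (u ⊗ₜ (v ⊗ₜ w)) = pair₂ P x (W.mul u v ⊗ₜ w) := by
  induction x with
  | zero => simp
  | add p q hp hq => simp only [map_add, LinearMap.add_apply, hp, hq]
  | tmul a b => rw [TensorProduct.map_tmul, pair₃_assoc, h.comul, pair₂_tmul, LinearMap.id_apply]

theorem pair₃_dual_comul_right (h : IsDual W W' P) (x : V' ⊗[k] V') (u v w : V) :
    pair₃ P (TensorProduct.map LinearMap.id W'.comul x)
      (u ⊗ₜ (v ⊗ₜ w)) = pair₂ P x (u ⊗ₜ W.mul v w) := by
  induction x with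
  | zero => simp
  | add p q hp hq => simp only [map_add, LinearMap.add_apply, hp, hq]
  | tmul a b => rw [TensorProduct.map_tmul, pair₃_tmul, h.comul, pair₂_tmul, LinearMap.id_apply]

theorem lid_counit (h : IsDual W W' P) (x : V' ⊗[k] V') (v : V) :
    P (TensorProduct.lid k V' (TensorProduct.map W'.counit LinearMap.id x)) v =
      pair₂ P x (W.one ⊗ₜ v) := by
  induction x with
  | zero => simp
  | add p q hp hq => simp only [map_add, LinearMap.add_apply, hp, hq]
  | tmul a b => simp [h.counit]

theorem rid_counit (h : IsDual W W' P) (x : V' ⊗[k] V') (v : V) :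
    P (TensorProduct.rid k V' (TensorProduct.map LinearMap.id W'.counit x)) v =
      pair₂ P x (v ⊗ₜ W.one) := by
  induction x with
  | zero => simp
  | add p q hp hq => simp only [map_add, LinearMap.add_apply, hp, hq]
  | tmul a b => simp [h.counit, mul_comm]

theorem pair₂_map₂ (h : IsDual W W' P) (x y : V' ⊗[k] V') (v w : V) :
    pair₂ P (TensorProduct.map₂ W'.mul W'.mul x y) (v ⊗ₜ w) =
      TensorProduct.dualDistrib k _ _ (pair₂ P x ⊗ₜ pair₂ P y)
        (TensorProduct.tensorTensorTensorComm k V V V V (W.comul v ⊗ₜ W.comul w)) := by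
  induction x with
  | zero => simp
  | add p q hp hq =>
    simp only [map_add, TensorProduct.add_tmul, LinearMap.add_apply, hp, hq]
  | tmul a b =>
    induction y with
    | zero => simp
    | add p q hp hq =>
      simp only [map_add, TensorProduct.tmul_add, LinearMap.add_apply, hp, hq]
    | tmul c d =>
      rw [TensorProduct.map₂_apply_tmul, TensorProduct.map_tmul, pair₂_tmul, h.mul, h.mul]
      generalize W.comul v = s
      generalize W.comul w = t
      induction s with
      | zero => simp
      | add p q hp hq => simp only [map_add, TensorProduct.add_tmul, add_mul, hp, hq]
      | tmul s₁ s₂ =>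
        induction t with
        | zero => simp
        | add p q hp hq => simp only [map_add, TensorProduct.tmul_add, mul_add, hp, hq]
        | tmul t₁ t₂ =>
          simp only [TensorProduct.tensorTensorTensorComm_tmul, pair₂_tmul,
            TensorProduct.dualDistrib_apply]
          ring

theorem pair₂_comul_comul (h : IsDual W W' P) (a b : V') (x y : V ⊗[k] V) :
    TensorProduct.dualDistrib k _ _ (pair₂ P (W'.comul a) ⊗ₜ pair₂ P (W'.comul b))
        (TensorProduct.tensorTensorTensorComm k V V V V (x ⊗ₜ y)) =
      pair₂ P (a ⊗ₜ b) (TensorProduct.map₂ W.mul W.mul x y) := by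
  induction x with
  | zero => simp
  | add p q hp hq =>
    simp only [map_add, TensorProduct.add_tmul, LinearMap.add_apply, hp, hq]
  | tmul s t =>
    induction y with
    | zero => simp
    | add p q hp hq =>
      simp only [map_add, TensorProduct.tmul_add, hp, hq]
    | tmul c d =>
      simp [h.comul]

/-- The regrouping `(p ⊗ q) ⊗ (p' ⊗ q') ↦ p ⊗ ((q ⊗ p') ⊗ q')`. -/
def regroup (k V : Type*) [Field k] [AddCommGroup V] [Module k V] :
    (V ⊗[k] V) ⊗[k] (V ⊗[k] V) →ₗ[k] V ⊗[k] ((V ⊗[k] V) ⊗[k] V) :=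
  TensorProduct.map LinearMap.id (TensorProduct.assoc k V V V).symm.toLinearMap ∘ₗ
    (TensorProduct.assoc k V V (V ⊗[k] V)).toLinearMap

theorem regroup_tmul (p q s t : V) :
    regroup k V ((p ⊗ₜ q) ⊗ₜ (s ⊗ₜ t)) = p ⊗ₜ ((q ⊗ₜ s) ⊗ₜ t) := rfl

theorem mul_pair₂ (P : V' →ₗ[k] Module.Dual k V) (f a b g : V') (x y : V ⊗[k] V) :
    pair₂ P (f ⊗ₜ a) x * pair₂ P (b ⊗ₜ g) y =
      TensorProduct.dualDistrib k _ _ (P f ⊗ₜ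
        TensorProduct.dualDistrib k _ _ (pair₂ P (a ⊗ₜ b) ⊗ₜ P g)) (regroup k V (x ⊗ₜ y)) := by
  induction x with
  | zero => simp
  | add p q hp hq => simp only [map_add, TensorProduct.add_tmul, add_mul, hp, hq]
  | tmul s₁ s₂ =>
    induction y with
    | zero => simp
    | add p q hp hq => simp only [map_add, TensorProduct.tmul_add, mul_add, hp, hq]
    | tmul t₁ t₂ =>
      simp only [regroup_tmul, pair₂_tmul, TensorProduct.dualDistrib_apply]
      ring

/-- The left side is `f(1₍₁₎) z(1₍₂₎ ⊗ 1'₍₁₎) g(1'₍₂₎)`, with two copies of `Δ(1)`. For `z = Δ(b)`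
this is `f ⊗ b ⊗ g` evaluated on `(Δ(1) ⊗ 1)(1 ⊗ Δ(1))`, as `pair₃_mul` shows; so the counit axiom
of the dual is the unit axiom of `W`. The flipped versions swap the legs of `z`. -/
theorem counit_mul_eq (h : IsDual W W' P) (f g : V') (z : V' ⊗[k] V') :
    LinearMap.mul' k k (TensorProduct.map (W'.counit ∘ₗ W'.mul f)
      (W'.counit ∘ₗ W'.mul.flip g) z) =
    TensorProduct.dualDistrib k _ _ (P f ⊗ₜ
        TensorProduct.dualDistrib k _ _ (pair₂ P z ⊗ₜ P g))
      (regroup k V (W.comul W.one ⊗ₜ W.comul W.one)) := by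
  induction z with
  | zero => simp
  | add p q hp hq =>
    simp only [map_add, TensorProduct.add_tmul, TensorProduct.tmul_add, LinearMap.add_apply, hp, hq]
  | tmul a b =>
    rw [← mul_pair₂]
    simp only [TensorProduct.map_tmul, LinearMap.mul'_apply, LinearMap.comp_apply,
      LinearMap.flip_apply, h.counit, h.mul]

theorem counit_mul_flip_eq (h : IsDual W W' P) (f g : V') (z : V' ⊗[k] V') :
    LinearMap.mul' k k (TensorProduct.map (W'.counit ∘ₗ W'.mul.flip g)
      (W'.counit ∘ₗ W'.mul f) z) =
    TensorProduct.dualDistrib k _ _ (P f ⊗ₜ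
        TensorProduct.dualDistrib k _ _ (pair₂ P (TensorProduct.comm k V' V' z) ⊗ₜ P g))
      (regroup k V (W.comul W.one ⊗ₜ W.comul W.one)) := by
  rw [← h.counit_mul_eq]
  induction z with
  | zero => simp
  | add p q hp hq => simp only [map_add, hp, hq]
  | tmul a b => simp [mul_comm]

theorem pair₂_comm (P : V' →ₗ[k] Module.Dual k V) (z : V' ⊗[k] V') (v w : V) :
    pair₂ P (TensorProduct.comm k V' V' z) (v ⊗ₜ w) = pair₂ P z (w ⊗ₜ v) := by
  induction z with
  | zero => simp
  | add p q hp hq => simp only [map_add, LinearMap.add_apply, hp, hq]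
  | tmul a b => simp [mul_comm]

theorem pair₃_mul (h : IsDual W W' P) (hW : W.IsWeakBialgebra) (f g c : V') (x y : V ⊗[k] V) :
    pair₃ P (f ⊗ₜ (g ⊗ₜ c)) (TensorProduct.map₂ W.mul (TensorProduct.map₂ W.mul W.mul)
      (TensorProduct.assoc k V V V (x ⊗ₜ[k] W.one)) (W.one ⊗ₜ[k] y)) =
    TensorProduct.dualDistrib k _ _ (P f ⊗ₜ
        TensorProduct.dualDistrib k _ _ (pair₂ P (W'.comul g) ⊗ₜ P c))
      (regroup k V (x ⊗ₜ y)) := by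
  induction x with
  | zero => simp
  | add p q hp hq => simp only [map_add, TensorProduct.add_tmul, LinearMap.add_apply, hp, hq]
  | tmul s₁ s₂ =>
    induction y with
    | zero => simp
    | add p q hp hq => simp only [map_add, TensorProduct.tmul_add, hp, hq]
    | tmul t₁ t₂ =>
      simp only [regroup_tmul, pair₃_tmul, pair₂_tmul, TensorProduct.dualDistrib_apply, h.comul,
        TensorProduct.assoc_tmul, TensorProduct.map₂_apply_tmul, TensorProduct.map_tmul,
        hW.one_mul, hW.mul_one]

theorem pair₃_mul_flip (h : IsDual W W' P) (hW : W.IsWeakBialgebra) (f g c : V')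
    (x y : V ⊗[k] V) :
    pair₃ P (f ⊗ₜ (g ⊗ₜ c)) (TensorProduct.map₂ W.mul (TensorProduct.map₂ W.mul W.mul)
      (W.one ⊗ₜ[k] y) (TensorProduct.assoc k V V V (x ⊗ₜ[k] W.one))) =
    TensorProduct.dualDistrib k _ _ (P f ⊗ₜ
        TensorProduct.dualDistrib k _ _
          (pair₂ P (TensorProduct.comm k V' V' (W'.comul g)) ⊗ₜ P c))
      (regroup k V (x ⊗ₜ y)) := by
  induction x with
  | zero => simp
  | add p q hp hq => simp only [map_add, TensorProduct.add_tmul, hp, hq]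
  | tmul s₁ s₂ =>
    induction y with
    | zero => simp
    | add p q hp hq =>
      simp only [map_add, TensorProduct.tmul_add, LinearMap.add_apply, hp, hq]
    | tmul t₁ t₂ =>
      simp only [regroup_tmul, pair₃_tmul, pair₂_tmul, TensorProduct.dualDistrib_apply, h.comul,
        TensorProduct.assoc_tmul, TensorProduct.map₂_apply_tmul, TensorProduct.map_tmul,
        hW.one_mul, hW.mul_one, pair₂_comm]

/-- For `y = z = Δ(1)` in the dual, the right side is `ε(u v₍₁₎) ε(v₍₂₎ w)`; so the unit axiom of
the dual is the counit axiom of `W`. -/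
theorem pair₃_dual_mul (h : IsDual W W' P) (h1 : ∀ a, W'.mul W'.one a = a)
    (h2 : ∀ a, W'.mul a W'.one = a) (y z : V' ⊗[k] V') (u v w : V) :
    pair₃ P (TensorProduct.map₂ W'.mul (TensorProduct.map₂ W'.mul W'.mul)
      (TensorProduct.assoc k V' V' V' (y ⊗ₜ[k] W'.one)) (W'.one ⊗ₜ[k] z)) (u ⊗ₜ (v ⊗ₜ w)) =
    LinearMap.mul' k k (TensorProduct.map (pair₂ P y ∘ₗ TensorProduct.mk k V V u)
      (pair₂ P z ∘ₗ (TensorProduct.mk k V V).flip w) (W.comul v)) := by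
  induction y with
  | zero => simp
  | add p q hp hq =>
    simp only [map_add, TensorProduct.add_tmul, LinearMap.add_apply, LinearMap.add_comp,
      TensorProduct.map_add_left, hp, hq]
  | tmul a b =>
    induction z with
    | zero => simp
    | add p q hp hq =>
      simp only [map_add, TensorProduct.tmul_add, LinearMap.add_apply, LinearMap.add_comp,
        TensorProduct.map_add_right, hp, hq]
    | tmul c d =>
      simp only [TensorProduct.assoc_tmul, TensorProduct.map₂_apply_tmul, TensorProduct.map_tmul,
        h1, h2, pair₃_tmul, pair₂_tmul, h.mul]
      generalize W.comul v = x
      induction x with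
      | zero => simp
      | add p q hp hq => simp only [map_add, mul_add, add_mul, hp, hq]
      | tmul s t =>
        simp
        ring

theorem pair₃_dual_mul_flip (h : IsDual W W' P) (h1 : ∀ a, W'.mul W'.one a = a)
    (h2 : ∀ a, W'.mul a W'.one = a) (y z : V' ⊗[k] V') (u v w : V) :
    pair₃ P (TensorProduct.map₂ W'.mul (TensorProduct.map₂ W'.mul W'.mul)
      (W'.one ⊗ₜ[k] z) (TensorProduct.assoc k V' V' V' (y ⊗ₜ[k] W'.one))) (u ⊗ₜ (v ⊗ₜ w)) =
    LinearMap.mul' k k (TensorProduct.map (pair₂ P z ∘ₗ (TensorProduct.mk k V V).flip w)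
      (pair₂ P y ∘ₗ TensorProduct.mk k V V u) (W.comul v)) := by
  induction y with
  | zero => simp
  | add p q hp hq =>
    simp only [map_add, TensorProduct.add_tmul, LinearMap.add_apply, LinearMap.add_comp,
      TensorProduct.map_add_right, hp, hq]
  | tmul a b =>
    induction z with
    | zero => simp
    | add p q hp hq =>
      simp only [map_add, TensorProduct.tmul_add, LinearMap.add_apply, LinearMap.add_comp,
        TensorProduct.map_add_left, hp, hq]
    | tmul c d =>
      simp only [TensorProduct.assoc_tmul, TensorProduct.map₂_apply_tmul, TensorProduct.map_tmul,
        h1, h2, pair₃_tmul, pair₂_tmul, h.mul]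
      generalize W.comul v = x
      induction x with
      | zero => simp
      | add p q hp hq => simp only [map_add, mul_add, add_mul, hp, hq]
      | tmul s t =>
        simp
        ring

/-- The dual of a finite-dimensional weak bialgebra is a weak bialgebra. -/
theorem isWeakBialgebra [FiniteDimensional k V] {P : V' ≃ₗ[k] Module.Dual k V}
    (h : IsDual W W' P.toLinearMap) (hW : W.IsWeakBialgebra) : W'.IsWeakBialgebra := by
  have hPe : ∀ f g : V', (∀ v, P.toLinearMap f v = P.toLinearMap g v) → f = g :=
    fun f g hfg => P.injective (LinearMap.ext hfg)
  have hassoc : ∀ a b c, W'.mul (W'.mul a b) c = W'.mul a (W'.mul b c) := fun a b c =>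
    hPe _ _ fun v => by
      rw [h.mul, h.mul, ← h.pair₃_comul_left, hW.coassoc, h.pair₃_comul_right]
  have hone_mul : ∀ a, W'.mul W'.one a = a := fun a => hPe _ _ fun v => by
    rw [h.mul]
    conv_rhs => rw [← hW.counit_left v]
    generalize W.comul v = x
    induction x with
    | zero => simp
    | add p q hp hq => simp only [map_add, hp, hq]
    | tmul s t => rw [pair₂_tmul, h.one]; simp
  have hmul_one : ∀ a, W'.mul a W'.one = a := fun a => hPe _ _ fun v => by
    rw [h.mul]
    conv_rhs => rw [← hW.counit_right v]
    generalize W.comul v = x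
    induction x with
    | zero => simp
    | add p q hp hq => simp only [map_add, hp, hq]
    | tmul s t => rw [pair₂_tmul, h.one]; simp [mul_comm]
  have hleft : ∀ u : V, pair₂ P.toLinearMap (W'.comul W'.one) ∘ₗ TensorProduct.mk k V V u =
      W.counit ∘ₗ W.mul u := fun u => LinearMap.ext fun v => by
    simp only [LinearMap.comp_apply, TensorProduct.mk_apply, h.comul, h.one]
  have hright : ∀ u : V,
      pair₂ P.toLinearMap (W'.comul W'.one) ∘ₗ (TensorProduct.mk k V V).flip u =
      W.counit ∘ₗ W.mul.flip u := fun u => LinearMap.ext fun v => by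
    simp only [LinearMap.comp_apply, LinearMap.flip_apply, TensorProduct.mk_apply, h.comul, h.one]
  exact
  { mul_assoc := hassoc
    one_mul := hone_mul
    mul_one := hmul_one
    coassoc := fun a => pair₃_ext P fun u v w => by
      rw [h.pair₃_dual_comul_left, h.pair₃_dual_comul_right, h.comul, h.comul, hW.mul_assoc]
    counit_left := fun a => hPe _ _ fun v => by rw [h.lid_counit, h.comul, hW.one_mul]
    counit_right := fun a => hPe _ _ fun v => by rw [h.rid_counit, h.comul, hW.mul_one]
    comul_mul := fun a b => pair₂_ext P fun v w => by
      rw [h.comul, h.mul, hW.comul_mul, h.pair₂_map₂, h.pair₂_comul_comul]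
    counit_mul := fun f g c => by
      rw [h.counit_mul_eq, ← h.pair₃_mul hW, ← hW.comul_one, h.pair₃_comul_right, ← h.mul,
        ← h.counit, hassoc]
    counit_mul_flip := fun f g c => by
      rw [h.counit_mul_flip_eq, ← h.pair₃_mul_flip hW, ← hW.comul_one_flip, h.pair₃_comul_right,
        ← h.mul, ← h.counit, hassoc]
    comul_one := pair₃_ext P fun u v w => by
      rw [h.pair₃_dual_comul_right, h.comul, h.one, h.pair₃_dual_mul hone_mul hmul_one, hleft,
        hright, ← hW.counit_mul, hW.mul_assoc]
    comul_one_flip := pair₃_ext P fun u v w => by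
      rw [h.pair₃_dual_comul_right, h.comul, h.one, h.pair₃_dual_mul_flip hone_mul hmul_one,
        hleft, hright, ← hW.counit_mul_flip, hW.mul_assoc] }

end IsDual

theorem pair₂_refl (x : Module.Dual k V ⊗[k] Module.Dual k V) :
    pair₂ (LinearEquiv.refl k (Module.Dual k V)).toLinearMap x =
      TensorProduct.dualDistrib k V V x := by
  induction x with
  | zero => simp
  | add p q hp hq => simp only [map_add, hp, hq]
  | tmul a b => simp [pair₂]

theorem dual_mul_apply [FiniteDimensional k V] (W : WeakBialgebraData k V)
    (f g : Module.Dual k V) (v : V) :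
    W.dual.mul f g v = TensorProduct.dualDistrib k V V (f ⊗ₜ g) (W.comul v) := rfl

theorem dualDistrib_dual_comul [FiniteDimensional k V] (W : WeakBialgebraData k V)
    (f : Module.Dual k V) (v w : V) :
    TensorProduct.dualDistrib k V V (W.dual.comul f) (v ⊗ₜ w) = f (W.mul v w) := by
  have h : TensorProduct.dualDistrib k V V (W.dual.comul f) =
      (TensorProduct.lift W.mul).dualMap f :=
    (TensorProduct.dualDistribEquiv k V V).apply_symm_apply _
  rw [h]
  rfl

theorem isDual_dual [FiniteDimensional k V] (W : WeakBialgebraData k V) :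
    IsDual W W.dual (LinearEquiv.refl k (Module.Dual k V)).toLinearMap where
  mul f g v := by
    rw [pair₂_refl, ← dual_mul_apply]
    rfl
  one v := rfl
  comul f v w := by
    rw [pair₂_refl, dualDistrib_dual_comul]
    rfl
  counit f := rfl

/-- The dual of a weak bialgebra, on a space identified with the dual space. -/
def dualVia [FiniteDimensional k V] (W : WeakBialgebraData k V) (P : V' ≃ₗ[k] Module.Dual k V) :
    WeakBialgebraData k V' where
  mul := (W.dual.mul.compl₁₂ P.toLinearMap P.toLinearMap).compr₂ P.symm.toLinearMap
  one := P.symm W.dual.one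
  comul := TensorProduct.map P.symm.toLinearMap P.symm.toLinearMap ∘ₗ W.dual.comul ∘ₗ P.toLinearMap
  counit := W.dual.counit ∘ₗ P.toLinearMap

theorem isDual_dualVia [FiniteDimensional k V] (W : WeakBialgebraData k V)
    (P : V' ≃ₗ[k] Module.Dual k V) : IsDual W (W.dualVia P) P.toLinearMap where
  mul f g v := by
    have h : P.toLinearMap ((W.dualVia P).mul f g) = W.dual.mul (P f) (P g) :=
      P.apply_symm_apply _
    rw [h, dual_mul_apply]
    rfl
  one v := by
    have h : P.toLinearMap (W.dualVia P).one = W.dual.one := P.apply_symm_apply _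
    rw [h]
    rfl
  comul f v w := by
    have h : ∀ x, pair₂ P.toLinearMap (TensorProduct.map P.symm.toLinearMap P.symm.toLinearMap x) =
        TensorProduct.dualDistrib k V V x := by
      intro x
      induction x with
      | zero => simp
      | add p q hp hq => simp only [map_add, hp, hq]
      | tmul a b => simp [pair₂]
    exact (LinearMap.congr_fun (h _) _).trans (W.dualDistrib_dual_comul (P f) v w)
  counit f := rfl

end WeakBialgebraData

/-! ### From weak bialgebras with base algebra `R` back to `×_R`-bialgebras -/

namespace EnvRing

variable {k : Type u} {R : Type v} {L : Type w} [Field k] [Ring R] [Algebra k R]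
  [AddCommGroup L] [Module k L]

/-- A comultiplication and a counit that make the algebra `L` of an `Rᵉ`-ring a weak bialgebra
whose base algebra is `R`, embedded by `η`. -/
structure IsWeakBialgebraOver (A : EnvRing k R L) (F : IdempotentFrobeniusSystem k R)
    (Δ : L →ₗ[k] L ⊗[k] L) (ε : L →ₗ[k] k) : Prop where
  weak : (WeakBialgebraData.mk A.mul A.one Δ ε).IsWeakBialgebra
  comul_env : ∀ r s : R, Δ (A.η (r ⊗ₜ[k] MulOpposite.op s)) =
    A.tmul (A.idem F) (A.src r ⊗ₜ[k] A.tgt s)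
  counit_mul_tgt : ∀ (f : L) (r : R), ε (A.mul f (A.tgt r)) = ε (A.mul f (A.src r))
  counit_src : ∀ r : R, ε (A.src r) = F.φ r

/-- The action `v ↦ (r ↦ e¹ ε(e² v r))`. -/
def counitEnd (A : EnvRing k R L) (F : IdempotentFrobeniusSystem k R) (ε : L →ₗ[k] k) :
    L →ₗ[k] Module.End k R :=
  LinearMap.mk₂ k (fun v r => TensorProduct.rid k R (TensorProduct.map LinearMap.id
      (ε ∘ₗ A.mul.flip (A.mul v (A.src r)) ∘ₗ A.src) F.e))
    (fun v w r => by
      simp only [map_add, LinearMap.add_apply, LinearMap.add_comp, LinearMap.comp_add,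
        TensorProduct.map_add_right])
    (fun c v r => by
      simp only [map_smul, LinearMap.smul_apply, LinearMap.smul_comp, LinearMap.comp_smul,
        TensorProduct.map_smul_right])
    (fun v r s => by
      simp only [map_add, LinearMap.add_apply, LinearMap.add_comp, LinearMap.comp_add,
        TensorProduct.map_add_right])
    (fun c v r => by
      simp only [map_smul, LinearMap.smul_apply, LinearMap.smul_comp, LinearMap.comp_smul,
        TensorProduct.map_smul_right])

/-- As `φ` is nondegenerate, this formula characterises the action; all its properties are derived
from it. -/
theorem φ_counitEnd (A : EnvRing k R L) (F : IdempotentFrobeniusSystem k R) (ε : L →ₗ[k] k)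
    (v : L) (r s : R) :
    F.φ (s * A.counitEnd F ε v r) = ε (A.mul (A.src s) (A.mul v (A.src r))) := by
  obtain ⟨S, hS, h1, -, -⟩ := F.exists_sum
  conv_rhs => rw [← h1 s]
  simp only [counitEnd, LinearMap.mk₂_apply, hS, map_sum, TensorProduct.map_tmul,
    TensorProduct.rid_tmul, Finset.mul_sum, mul_smul_comm, map_smul, LinearMap.id_apply,
    LinearMap.comp_apply, LinearMap.flip_apply, LinearMap.sum_apply, LinearMap.smul_apply,
    smul_eq_mul]
  exact Finset.sum_congr rfl fun _ _ => mul_comm _ _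

theorem counitEnd_mul_src (A : EnvRing k R L) (F : IdempotentFrobeniusSystem k R) (ε : L →ₗ[k] k)
    (l : L) (r : R) : A.counitEnd F ε (A.mul l (A.src r)) 1 = A.counitEnd F ε l r :=
  F.ext_left fun s => by rw [φ_counitEnd, φ_counitEnd, src_one, A.mul_one]

namespace IsWeakBialgebraOver

variable {A : EnvRing k R L} {F : IdempotentFrobeniusSystem k R}
    {Δ : L →ₗ[k] L ⊗[k] L} {ε : L →ₗ[k] k} (h : A.IsWeakBialgebraOver F Δ ε)

include h

theorem comul_mul (a b : L) : Δ (A.mul a b) = A.tmul (Δ a) (Δ b) := h.weak.comul_mul a b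

theorem idem_mul_comul (l : L) : A.tmul (A.idem F) (Δ l) = Δ l := by
  rw [← comul_one h.comul_env, ← h.comul_mul, A.one_mul]

theorem comul_mul_idem (l : L) : A.tmul (Δ l) (A.idem F) = Δ l := by
  rw [← comul_one h.comul_env, ← h.comul_mul, A.mul_one]

theorem idem_mul_eq {x : L ⊗[k] L} {l : L} (hx : A.cls x = A.cls (Δ l)) :
    A.tmul (A.idem F) x = Δ l := by
  rw [(A.cls_eq_iff F).1 hx, h.idem_mul_comul]

/-- Weak multiplicativity with middle factor `1`, where `Δ(1) = E`: `ε(f l) = ε(f e̅¹) ε(e² l) = ε(f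
e¹) ε(e² l)`. -/
theorem counit_mul_eq (f l : L) : ε (A.mul f l) = ε (A.mul f (A.src (A.counitEnd F ε l 1))) := by
  obtain ⟨S, hS, h1, -, -⟩ := F.exists_sum
  have := h.weak.counit_mul f A.one l
  simp only [comul_one h.comul_env, A.mul_one, idem, hS, map_sum, TensorProduct.map_tmul,
    LinearMap.mul'_apply, LinearMap.comp_apply, LinearMap.flip_apply, h.counit_mul_tgt] at this
  rw [this]
  simp only [counitEnd, LinearMap.mk₂_apply, hS, map_sum, TensorProduct.map_tmul,
    TensorProduct.rid_tmul, map_smul, LinearMap.id_apply, src_one, A.mul_one,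
    LinearMap.comp_apply, LinearMap.flip_apply, smul_eq_mul]
  exact Finset.sum_congr rfl fun _ _ => mul_comm _ _

theorem counit_tgt_mul (a : R) (m : L) :
    ε (A.mul (A.tgt a) m) = F.φ (A.counitEnd F ε m 1 * a) := by
  rw [h.counit_mul_eq, tgt_mul_src, h.counit_mul_tgt, src_mul, h.counit_src]

/-- Writing `C` for the action, `φ(s C(ab)(r)) = ε(s a b r) = ε(s a C(br)(1))`, and `C(br)(1) =
C(b)(r)`. -/
theorem counitEnd_mul (a b : L) :
    A.counitEnd F ε (A.mul a b) = A.counitEnd F ε a * A.counitEnd F ε b := by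
  refine LinearMap.ext fun r => F.ext_left fun s => ?_
  rw [Module.End.mul_apply, φ_counitEnd, φ_counitEnd, ← A.counitEnd_mul_src F ε b, ← A.mul_assoc,
    ← A.mul_assoc, ← A.mul_assoc, ← h.counit_mul_eq, A.mul_assoc (A.mul _ _)]

theorem counitEnd_env (r s t : R) :
    A.counitEnd F ε (A.η (r ⊗ₜ[k] MulOpposite.op s)) t = r * t * s := by
  refine F.ext_left fun x => ?_
  rw [φ_counitEnd, ← src_mul_tgt, A.mul_assoc, tgt_mul_src, src_src, src_src, h.counit_mul_tgt,
    src_mul, h.counit_src]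
  simp only [_root_.mul_assoc]

omit h in
/-- The `×_R`-bialgebra that corresponds to a weak bialgebra with base algebra `R`. -/
def toTakeuchi (h : A.IsWeakBialgebraOver F Δ ε) : TakeuchiBialgebra k R L where
  toEnvRing := A
  Γ := A.cls ∘ₗ Δ
  Γ_mem l := by
    -- `Δ(l) = Δ(l)E`, and `E` does not distinguish `s̄ ⊗ 1` from `1 ⊗ s`.
    refine (Submodule.mem_iInf _).2 fun s => ?_
    rw [LinearMap.mem_ker, LinearMap.sub_apply, LinearMap.comp_apply, diamondRight_cls,
      diamondRight_cls, sub_eq_zero, ← h.comul_mul_idem l, A.tmul_assoc, A.tmul_assoc, idem_tgt]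
  Γ_mul a b x y hx hy := by
    -- The choice of representatives is immaterial: `E x y = Δ(a) y = Δ(a) E y = Δ(a)Δ(b)`.
    rw [LinearMap.comp_apply, A.cls_eq_iff F, h.idem_mul_comul, ← A.tmul_assoc,
      h.idem_mul_eq hx, ← h.comul_mul_idem a, A.tmul_assoc, h.idem_mul_eq hy, h.comul_mul]
  Γ_env r s := by rw [LinearMap.comp_apply, h.comul_env, cls_idem]
  C := A.counitEnd F ε
  C_mul := h.counitEnd_mul
  C_env := h.counitEnd_env
  coassoc l x hx := by
    rw [lift_joinLeft, lift_joinRight, A.triple_eq_iff F,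
      ← comul_left_idem_mul h.comul_mul h.comul_env,
      ← comul_right_idem_mul h.comul_mul h.comul_env, h.idem_mul_eq hx]
    exact h.weak.coassoc l
  counit_right l x hx := by
    rw [← A.rid_counit_idem F (ε := ε) (c := (A.counitEnd F ε).flip 1) (fun a m => by
      rw [LinearMap.flip_apply, φ_counitEnd, src_one, A.mul_one]), h.idem_mul_eq hx]
    exact h.weak.counit_right l
  counit_left l x hx := by
    rw [← A.lid_counit_idem F (ε := ε) (c := (A.counitEnd F ε).flip 1) h.counit_tgt_mul,
      h.idem_mul_eq hx]
    exact h.weak.counit_left l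

end IsWeakBialgebraOver

end EnvRing

/-! ### `Hom_{R̄}(L, R)` as the dual space of `L` -/

open WeakBialgebraData

namespace EnvRing

variable {k : Type u} {R : Type v} {L : Type w} [Field k] [Ring R] [Algebra k R]
  [AddCommGroup L] [Module k L] (A : EnvRing k R L) (F : IdempotentFrobeniusSystem k R)

theorem leftDual_tgt (ξ : A.leftDual) (r : R) (h : L) :
    ξ.1 (A.mul (A.tgt r) h) = ξ.1 h * r := ξ.2 r h

/-- The map `a ⊗ b ↦ (h ↦ f(a̅ h) b)`, for a linear form `f`. -/
def tgtSlice (f : Module.Dual k L) : R ⊗[k] R →ₗ[k] L →ₗ[k] R :=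
  TensorProduct.lift (LinearMap.mk₂ k
    (fun a b => (f ∘ₗ A.mul (A.tgt a)).smulRight b)
    (fun a b c => by ext h; simp [add_smul])
    (fun c a b => by ext h; simp [mul_smul])
    (fun a b c => by ext h; simp)
    (fun c a b => by ext h; simp [smul_comm c]))

theorem tgtSlice_tmul (f : Module.Dual k L) (a b : R) (h : L) :
    A.tgtSlice f (a ⊗ₜ b) h = f (A.mul (A.tgt a) h) • b := rfl

/-- The element `h ↦ f(e̅¹ h) e²` of `Hom_{R̄}(L, R)` that corresponds to a linear form `f`. -/
def leftDualOf (f : Module.Dual k L) : A.leftDual :=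
  ⟨A.tgtSlice f F.e, by
    intro r h
    have h1 : ∀ t : R ⊗[k] R, A.tgtSlice f t (A.mul (A.tgt r) h) =
        A.tgtSlice f (TensorProduct.map (LinearMap.mulLeft k r) LinearMap.id t) h := by
      intro t
      induction t with
      | zero => simp
      | tmul c d => simp [tgtSlice_tmul, tgt_tgt]
      | add p q hp hq => simp only [map_add, LinearMap.add_apply, hp, hq]
    rw [h1, F.casimir]
    generalize F.e = t
    induction t with
    | zero => simp
    | tmul c d => simp [tgtSlice_tmul]
    | add p q hp hq => simp only [map_add, LinearMap.add_apply, hp, hq, add_mul]⟩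

/-- Uses `e¹ φ(e²) = 1`, the Frobenius identity at `r = 1`. -/
theorem φ_leftDualOf (f : Module.Dual k L) (h : L) : F.φ ((A.leftDualOf F f).1 h) = f h := by
  obtain ⟨S, hS, -, h1, -⟩ := F.exists_sum
  have := h1 1
  simp only [_root_.mul_one] at this
  conv_rhs => rw [← A.one_mul h, ← A.tgt_one, ← this]
  simp only [leftDualOf, hS, map_sum, tgtSlice_tmul, LinearMap.sum_apply, map_smul,
    LinearMap.smul_apply, smul_eq_mul]
  exact Finset.sum_congr rfl fun _ _ => mul_comm _ _

/-- The identifications of `V'` with the dual space of `V`. -/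
abbrev DualEquiv (k V V' : Type*) [Field k] [AddCommGroup V] [Module k V] [AddCommGroup V']
    [Module k V'] : Type _ :=
  V' ≃ₗ[k] Module.Dual k V

/-- The bijection `ξ ↦ φ ∘ ξ` of `Hom_{R̄}(L, R)` with the dual space of `L`. -/
def leftDualEquiv : DualEquiv k L A.leftDual :=
  LinearEquiv.ofBijective
    ((LinearMap.compRight k F.φ) ∘ₗ A.leftDual.subtype)
    -- `φ(ξ(h)s) = φ(ξ(s̄h))`, so `φ ∘ ξ` determines every value `ξ(h)`.
    ⟨fun ξ ζ hξ => Subtype.ext (LinearMap.ext fun h => F.ext_right fun s => by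
      rw [← A.leftDual_tgt, ← A.leftDual_tgt]
      exact LinearMap.congr_fun hξ _),
    fun f => ⟨A.leftDualOf F f, LinearMap.ext fun h => A.φ_leftDualOf F f h⟩⟩

theorem leftDualEquiv_apply (ξ : A.leftDual) (h : L) :
    A.leftDualEquiv F ξ h = F.φ (ξ.1 h) := rfl

theorem leftDual_ext {ξ ζ : A.leftDual} (h : ∀ l, ξ.1 l = ζ.1 l) : ξ = ζ :=
  Subtype.ext (LinearMap.ext h)

/-- `φ(ξ(e̅¹m)) φ(ζ(e²n)) = φ(ξ(m)e¹) φ(ζ(e²n)) = φ(ζ(ξ(m)n))`. Hence the convolution product of `φ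
∘ ξ` and `φ ∘ ζ` is what a skew pairing prescribes for `ζξ`; this is why the opposite of the dual
appears. -/
theorem pair₂_leftDual (ξ ζ : A.leftDual) (x : L ⊗[k] L) :
    pair₂ (V' := A.leftDual) (V := L) (A.leftDualEquiv F).toLinearMap (ξ ⊗ₜ ζ)
      (A.tmul (A.idem F) x) =
      F.φ (ζ.1 (TensorProduct.lift (A.mul ∘ₗ A.src ∘ₗ ξ.1) x)) := by
  obtain ⟨S, hS, h1, -, -⟩ := F.exists_sum
  induction x with
  | zero => simp
  | add p q hp hq => simp only [map_add, hp, hq]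
  | tmul m n =>
    rw [TensorProduct.lift.tmul, LinearMap.comp_apply, LinearMap.comp_apply]
    conv_rhs => rw [← h1 (ξ.1 m)]
    simp only [idem, hS, map_sum, LinearMap.sum_apply, TensorProduct.map_tmul, tmul_tmul,
      pair₂_tmul, LinearEquiv.coe_coe, leftDualEquiv_apply, leftDual_tgt, map_smul,
      LinearMap.smul_apply, smul_eq_mul]

/-- If `R` and `R̄` act on `Hom_{R̄}(L, R)` by `(r ξ)(h) = r ξ(h)` and `(s̄ ξ)(h) = ξ(h s̄)`, then
`φ ⊗ φ` applied to `(e̅¹ ξ)(v) ⊗ (e² ζ)(w)` is `φ` applied to `(ζ(w)‾ ξ)(v)`. -/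
theorem pair₂_idem_leftDual {A' : EnvRing k R A.leftDual}
    (hsrc : ∀ r ξ h, (A'.mul (A'.src r) ξ).1 h = r * ξ.1 h)
    (htgt : ∀ r ξ h, (A'.mul (A'.tgt r) ξ).1 h = ξ.1 (A.mul h (A.tgt r)))
    (x : A.leftDual ⊗[k] A.leftDual) (v w : L) :
    pair₂ (V' := A.leftDual) (V := L) (A.leftDualEquiv F).toLinearMap
      (A'.tmul (A'.idem F) x) (v ⊗ₜ w) =
      F.φ ((TensorProduct.lift
        (A'.mul ∘ₗ A'.tgt ∘ₗ A.leftDual.subtype.flip w).flip x).1 v) := by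
  obtain ⟨S, hS, -, h1, -⟩ := F.exists_sum
  induction x with
  | zero => simp
  | add p q hp hq =>
    simp only [map_add, LinearMap.add_apply, hp, hq, Submodule.coe_add]
  | tmul ξ ζ =>
    rw [TensorProduct.lift.tmul, LinearMap.flip_apply, LinearMap.comp_apply, LinearMap.comp_apply,
      htgt, LinearMap.flip_apply, Submodule.subtype_apply]
    conv_rhs => rw [← h1 (ζ.1 w)]
    simp only [idem, hS, map_sum, LinearMap.sum_apply, TensorProduct.map_tmul, tmul_tmul,
      pair₂_tmul, LinearEquiv.coe_coe, leftDualEquiv_apply, hsrc, htgt, map_smul,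
      smul_eq_mul]
    exact Finset.sum_congr rfl fun _ _ => mul_comm _ _

end EnvRing

/-! ### The `×_R`-bialgebra structure on `Hom_{R̄}(L, R)` -/

namespace TakeuchiBialgebra

variable {k : Type u} {R : Type v} {L : Type w} [Field k] [Ring R] [Algebra k R]
  [AddCommGroup L] [Module k L] (B : TakeuchiBialgebra k R L) (F : IdempotentFrobeniusSystem k R)

theorem Γ_src (r : R) : B.Γ (B.src r) = B.cls (B.src r ⊗ₜ[k] B.one) := by
  have := B.Γ_env r 1
  rwa [← B.src_mul_tgt, B.tgt_one, B.mul_one] at this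

theorem Γ_tgt (s : R) : B.Γ (B.tgt s) = B.cls (B.one ⊗ₜ[k] B.tgt s) := by
  have := B.Γ_env 1 s
  rwa [← B.src_mul_tgt, B.src_one, B.one_mul] at this

/-- The elements `h ↦ r C(h)(s)` of `Hom_{R̄}(L, R)`. -/
def dualEnv : R ⊗[k] Rᵐᵒᵖ →ₗ[k] B.leftDual :=
  TensorProduct.lift (LinearMap.mk₂ k
    (fun r s => ⟨LinearMap.mulLeft k r ∘ₗ B.C.flip s.unop, fun t h => by
      simp [C_tgt_mul, mul_assoc]⟩)
    (fun r r' s => B.leftDual_ext fun h => by simp [add_mul])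
    (fun c r s => B.leftDual_ext fun h => by simp)
    (fun r s s' => B.leftDual_ext fun h => by simp [mul_add])
    (fun c r s => B.leftDual_ext fun h => by simp))

theorem dualEnv_apply (r s : R) (h : L) :
    (B.dualEnv (r ⊗ₜ[k] MulOpposite.op s)).1 h = r * B.C h s := rfl

variable [FiniteDimensional k L]

/-- The dual of the weak bialgebra of `L`, on the space `Hom_{R̄}(L, R)`. -/
def dualWeakOp : WeakBialgebraData k B.leftDual :=
  (B.toWeak F).dualVia (V' := B.leftDual) (B.leftDualEquiv F)

theorem isDual_dualWeakOp : IsDual (V' := B.leftDual) (B.toWeak F) (B.dualWeakOp F)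
    (B.leftDualEquiv F).toLinearMap :=
  isDual_dualVia _ _

/-- The weak bialgebra structure of `Hom_{R̄}(L, R)`. -/
def dualWeak : WeakBialgebraData k B.leftDual := (B.dualWeakOp F).op

theorem dualWeak_isWeakBialgebra : (B.dualWeak F).IsWeakBialgebra :=
  ((B.isDual_dualWeakOp F).isWeakBialgebra (B.toWeak_isWeakBialgebra F)).op

theorem leftDualEquiv_dualWeak_mul (ξ ζ : B.leftDual) (h : L) :
    B.leftDualEquiv F ((B.dualWeak F).mul ξ ζ) h =
      pair₂ (V' := B.leftDual) (V := L) (B.leftDualEquiv F).toLinearMap (ζ ⊗ₜ ξ)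
        ((B.toWeak F).comul h) :=
  (B.isDual_dualWeakOp F).mul ζ ξ h

theorem leftDualEquiv_dualWeak_one (h : L) :
    B.leftDualEquiv F (B.dualWeak F).one h = F.φ (B.C h 1) :=
  (B.isDual_dualWeakOp F).one h

theorem pair₂_dualWeak_comul (ξ : B.leftDual) (v w : L) :
    pair₂ (V' := B.leftDual) (V := L) (B.leftDualEquiv F).toLinearMap
      ((B.dualWeak F).comul ξ) (v ⊗ₜ w) =
      F.φ (ξ.1 (B.mul v w)) :=
  (B.isDual_dualWeakOp F).comul ξ v w

theorem dualWeak_counit (ξ : B.leftDual) : (B.dualWeak F).counit ξ = F.φ (ξ.1 B.one) :=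
  (B.isDual_dualWeakOp F).counit ξ

theorem dualWeak_mul_apply (ξ ζ : B.leftDual) (g : L) (x : L ⊗[k] L) (hx : B.cls x = B.Γ g) :
    ((B.dualWeak F).mul ξ ζ).1 g = ξ.1 (TensorProduct.lift (B.mul ∘ₗ B.src ∘ₗ ζ.1) x) := by
  -- The dual over `k` only sees `φ ∘ ξ`. Evaluating at `s̄ g` for all `s` recovers the value in
  -- `R`, as both sides are `R̄`-linear in `g`.
  refine F.ext_right fun s => ?_
  have hs : B.cls (B.tmul (B.one ⊗ₜ[k] B.tgt s) x) = B.Γ (B.mul (B.tgt s) g) :=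
    (B.Γ_mul _ _ _ _ (B.Γ_tgt s).symm hx).symm
  have hl : TensorProduct.lift (B.mul ∘ₗ B.src ∘ₗ ζ.1) (B.tmul (B.one ⊗ₜ[k] B.tgt s) x) =
      B.mul (B.tgt s) (TensorProduct.lift (B.mul ∘ₗ B.src ∘ₗ ζ.1) x) := by
    clear hx hs
    induction x with
    | zero => simp
    | add p q hp hq => simp only [map_add, hp, hq]
    | tmul m n => simp [EnvRing.tmul_tmul, B.one_mul, EnvRing.tgt_src]
  rw [← B.leftDual_tgt, ← B.leftDual_tgt, ← hl, ← B.pair₂_leftDual, ← B.toWeak_comul_eq F hs,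
    ← leftDualEquiv_dualWeak_mul, B.leftDualEquiv_apply]

/-- `r C(ξ(g₍₁₎)g₍₂₎)(s) = r ξ(g₍₁₎) C(g₍₂₎)(s)`. The last factor enters `ξ` as the bar of `C(g₍₂₎
s̄)(1)`, and the counit axiom for `g s̄` applies. -/
theorem dualEnv_mul (r s : R) (ξ : B.leftDual) (g : L) :
    ((B.dualWeak F).mul (B.dualEnv (r ⊗ₜ[k] MulOpposite.op s)) ξ).1 g =
      r * ξ.1 (B.mul g (B.tgt s)) := by
  obtain ⟨x, hx⟩ := B.diamondRel.mkQ_surjective (B.Γ g)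
  change B.cls x = B.Γ g at hx
  have hs : B.cls (B.tmul x (B.one ⊗ₜ[k] B.tgt s)) = B.Γ (B.mul g (B.tgt s)) :=
    (B.Γ_mul _ _ _ _ hx (B.Γ_tgt s).symm).symm
  rw [B.dualWeak_mul_apply F _ _ g x hx, ← B.counit_right _ _ hs, dualEnv_apply]
  congr 1
  clear hx hs
  induction x with
  | zero => simp
  | add p q hp hq => simp only [map_add, LinearMap.add_apply, hp, hq]
  | tmul m n =>
    simp [EnvRing.tmul_tmul, B.mul_one, C_src_mul, C_mul_tgt, EnvRing.leftDual_tgt]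

/-- `ξ(t C(g₍₁₎)(u) g₍₂₎)` with `C(g₍₁₎)(u) = C(g₍₁₎u)(1)`, followed by the counit axiom for `g u`.
-/
theorem mul_dualEnv (t u : R) (ξ : B.leftDual) (g : L) :
    ((B.dualWeak F).mul ξ (B.dualEnv (t ⊗ₜ[k] MulOpposite.op u))).1 g =
      ξ.1 (B.mul (B.src t) (B.mul g (B.src u))) := by
  obtain ⟨x, hx⟩ := B.diamondRel.mkQ_surjective (B.Γ g)
  change B.cls x = B.Γ g at hx
  have hs : B.cls (B.tmul x (B.src u ⊗ₜ[k] B.one)) = B.Γ (B.mul g (B.src u)) :=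
    (B.Γ_mul _ _ _ _ hx (B.Γ_src u).symm).symm
  rw [B.dualWeak_mul_apply F _ _ g x hx, ← B.counit_left _ _ hs]
  congr 1
  clear hx hs
  induction x with
  | zero => simp
  | add p q hp hq => simp only [map_add, LinearMap.add_apply, hp, hq]
  | tmul m n =>
    simp [EnvRing.tmul_tmul, B.mul_one, C_mul_src, dualEnv_apply, EnvRing.src_src]

theorem dualWeak_one : (B.dualWeak F).one = B.dualEnv 1 := by
  refine (B.leftDualEquiv F).injective (LinearMap.ext fun h => ?_)
  rw [leftDualEquiv_dualWeak_one, B.leftDualEquiv_apply, Algebra.TensorProduct.one_def,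
    ← MulOpposite.op_one, dualEnv_apply, one_mul]

/-- The `Rᵉ`-ring `Hom_{R̄}(L, R)`. -/
def dualRing : EnvRing k R B.leftDual where
  mul := (B.dualWeak F).mul
  one := (B.dualWeak F).one
  mul_assoc := (B.dualWeak_isWeakBialgebra F).mul_assoc
  one_mul := (B.dualWeak_isWeakBialgebra F).one_mul
  mul_one := (B.dualWeak_isWeakBialgebra F).mul_one
  η := B.dualEnv
  η_one := (B.dualWeak_one F).symm
  η_mul x y := by
    induction x with
    | zero => simp
    | add p q hp hq => simp only [map_add, add_mul, LinearMap.add_apply, hp, hq]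
    | tmul r s =>
      induction y with
      | zero => simp
      | add p q hp hq => simp only [map_add, mul_add, hp, hq]
      | tmul r' s' =>
        obtain ⟨s, rfl⟩ := MulOpposite.op_surjective s
        obtain ⟨s', rfl⟩ := MulOpposite.op_surjective s'
        refine B.leftDual_ext fun h => ?_
        rw [dualEnv_mul, Algebra.TensorProduct.tmul_mul_tmul, ← MulOpposite.op_mul,
          dualEnv_apply, dualEnv_apply, C_mul_tgt, mul_assoc]

theorem dualRing_src_mul (r : R) (ξ : B.leftDual) (h : L) :
    ((B.dualRing F).mul ((B.dualRing F).src r) ξ).1 h = r * ξ.1 h := by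
  have := B.dualEnv_mul F r 1 ξ h
  rwa [B.tgt_one, B.mul_one] at this

theorem dualRing_tgt_mul (s : R) (ξ : B.leftDual) (h : L) :
    ((B.dualRing F).mul ((B.dualRing F).tgt s) ξ).1 h = ξ.1 (B.mul h (B.tgt s)) := by
  have := B.dualEnv_mul F 1 s ξ h
  rwa [one_mul] at this

theorem dualRing_src_apply (r : R) (h : L) : ((B.dualRing F).src r).1 h = r * B.C h 1 := rfl

theorem dualRing_tgt_apply (r : R) (h : L) : ((B.dualRing F).tgt r).1 h = B.C h r := by
  have := B.dualEnv_apply 1 r h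
  rwa [one_mul] at this

theorem dualRing_isWeakBialgebraOver : (B.dualRing F).IsWeakBialgebraOver F
    (B.dualWeak F).comul (B.dualWeak F).counit where
  weak := B.dualWeak_isWeakBialgebra F
  comul_env r s := pair₂_ext (V' := B.leftDual) (V := L) (B.leftDualEquiv F) fun v w => by
    rw [pair₂_dualWeak_comul, B.pair₂_idem_leftDual F (B.dualRing_src_mul F)
      (B.dualRing_tgt_mul F), TensorProduct.lift.tmul, LinearMap.flip_apply,
      LinearMap.comp_apply, LinearMap.comp_apply, dualRing_tgt_mul, LinearMap.flip_apply,
      Submodule.subtype_apply, dualRing_tgt_apply, dualRing_src_apply, C_mul_tgt, one_mul]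
    change F.φ (r * B.C (B.mul v w) s) = _
    rw [B.C_mul, Module.End.mul_apply]
  -- Right multiplication by `t ⊗ ū` evaluates `f` at `t g u`; at `g = 1` both `r̄` and `r` give
  -- `f(r)`.
  counit_mul_tgt f r := by
    have h1 := B.mul_dualEnv F 1 r f B.one
    have h2 := B.mul_dualEnv F r 1 f B.one
    rw [B.src_one, B.one_mul, B.one_mul] at h1
    rw [B.src_one, B.one_mul, B.mul_one] at h2
    rw [dualWeak_counit, dualWeak_counit]
    exact congrArg F.φ (h1.trans h2.symm)
  counit_src r := by
    rw [dualWeak_counit, dualRing_src_apply, ← B.src_one, C_src, mul_one, mul_one]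

/-- The `×_R`-bialgebra `Hom_{R̄}(L, R)`. -/
def leftDualTakeuchi : TakeuchiBialgebra k R B.leftDual :=
  (B.dualRing_isWeakBialgebraOver F).toTakeuchi

theorem leftDualTakeuchi_isSkewPairing :
    IsSkewPairing (B.leftDualTakeuchi F) B B.leftDual.subtype where
  bimod r s t u v ξ h := by
    have h1 := B.mul_dualEnv F t u
      ((B.dualWeak F).mul (B.dualEnv (r ⊗ₜ[k] MulOpposite.op s)) ξ) h
    rw [dualEnv_mul] at h1
    change ((B.dualWeak F).mul ((B.dualWeak F).mul (B.dualEnv (r ⊗ₜ[k] MulOpposite.op s)) ξ)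
      (B.dualEnv (t ⊗ₜ[k] MulOpposite.op u))).1 h * v = r * ξ.1 _
    rw [h1, mul_assoc, ← B.leftDual_tgt, ← B.src_mul_tgt, ← B.src_mul_tgt, ← B.tgt_mul_src]
    simp only [B.mul_assoc]
  mul_right ξ g h x hx := by
    have hx' : (B.dualRing F).tmul ((B.dualRing F).idem F) x = (B.dualWeak F).comul ξ :=
      (B.dualRing_isWeakBialgebraOver F).idem_mul_eq hx
    -- Replacing `g` by `s̄ g` again passes from values of `φ` to values in `R`.
    refine F.ext_right fun s => ?_
    rw [Submodule.subtype_apply, Submodule.subtype_apply, ← B.leftDual_tgt, ← B.leftDual_tgt,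
      ← B.mul_assoc, ← pair₂_dualWeak_comul, ← hx', B.pair₂_idem_leftDual F
      (B.dualRing_src_mul F) (B.dualRing_tgt_mul F)]
    rfl
  one_right ξ := by
    refine F.ext_left fun s => ?_
    have h1 := (B.dualRing F).φ_counitEnd F (B.dualWeak F).counit ξ 1 s
    rw [EnvRing.src_one, EnvRing.mul_one, dualWeak_counit, dualRing_src_mul] at h1
    exact h1.symm
  mul_left ξ ζ g x hx := B.dualWeak_mul_apply F ξ ζ g x hx
  one_left h := by
    change (B.dualWeak F).one.1 h = _
    rw [dualWeak_one, Algebra.TensorProduct.one_def, ← MulOpposite.op_one, dualEnv_apply, one_mul]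

end TakeuchiBialgebra

/-! ### Every structure making evaluation a skew pairing: isomorphism with the opposite dual, and
uniqueness -/

namespace IsSkewPairing

variable {k : Type u} {R : Type v} {L : Type w} [Field k] [Ring R] [Algebra k R]
  [AddCommGroup L] [Module k L] {B : TakeuchiBialgebra k R L}
  {D : TakeuchiBialgebra k R B.leftDual} (hD : IsSkewPairing D B B.leftDual.subtype)
  (F : IdempotentFrobeniusSystem k R)

include hD

theorem env_mul_apply (r s : R) (ξ : B.leftDual) (h : L) :
    (D.mul (D.η (r ⊗ₜ[k] MulOpposite.op s)) ξ).1 h = r * ξ.1 (B.mul h (B.tgt s)) := by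
  have := hD.bimod r s 1 1 1 ξ h
  simpa only [← EnvRing.src_mul_tgt, EnvRing.src_one, EnvRing.tgt_one, D.mul_one, B.one_mul,
    mul_one, Submodule.subtype_apply] using this

/-- The algebra map `η` is forced: apply the bimodule axiom to the unit of `D`, whose values are
`C(h)(1)`. -/
theorem env_apply (r s : R) (h : L) :
    (D.η (r ⊗ₜ[k] MulOpposite.op s)).1 h = r * B.C h s := by
  have h1 := hD.env_mul_apply r s D.one h
  have h2 := hD.one_left (B.mul h (B.tgt s))
  rw [Submodule.subtype_apply, B.C_mul_tgt, one_mul] at h2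
  rwa [D.mul_one, h2] at h1

theorem src_mul_apply (r : R) (ξ : B.leftDual) (h : L) :
    (D.mul (D.src r) ξ).1 h = r * ξ.1 h := by
  have := hD.env_mul_apply r 1 ξ h
  rwa [B.tgt_one, B.mul_one] at this

theorem tgt_mul_apply (s : R) (ξ : B.leftDual) (h : L) :
    (D.mul (D.tgt s) ξ).1 h = ξ.1 (B.mul h (B.tgt s)) := by
  have := hD.env_mul_apply 1 s ξ h
  rwa [one_mul] at this

variable [FiniteDimensional k L]

/-- Each of the four skew pairing axioms on products and units gives one compatibility after
applying `φ`. -/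
theorem isIso : (D.toWeak F).IsIso (B.toWeak F).dual.op (B.leftDualEquiv F) where
  map_mul ξ ζ := LinearMap.ext fun h => by
    change F.φ ((D.mul ξ ζ).1 h) =
      pair₂ (V' := B.leftDual) (V := L) (B.leftDualEquiv F).toLinearMap (ζ ⊗ₜ ξ)
      ((B.toWeak F).comul h)
    rw [← B.idem_toWeak_comul, B.pair₂_leftDual]
    exact congrArg F.φ (hD.mul_left ξ ζ h _ (B.cls_toWeak_comul F h))
  map_one := LinearMap.ext fun h => congrArg F.φ (hD.one_left h)
  map_comul ξ := dualDistrib_injective (TensorProduct.ext' fun v w => by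
    refine Eq.trans ?_ ((B.toWeak F).dualDistrib_dual_comul (B.leftDualEquiv F ξ) v w).symm
    change pair₂ (V' := B.leftDual) (V := L) (B.leftDualEquiv F).toLinearMap
      ((D.toWeak F).comul ξ) (v ⊗ₜ w) = _
    rw [← D.idem_toWeak_comul, B.pair₂_idem_leftDual F hD.src_mul_apply hD.tgt_mul_apply]
    exact congrArg F.φ (hD.mul_right ξ v w _ (D.cls_toWeak_comul F ξ)).symm)
  map_counit ξ := congrArg F.φ (hD.one_right ξ)

include F in
theorem unique {D' : TakeuchiBialgebra k R B.leftDual}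
    (hD' : IsSkewPairing D' B B.leftDual.subtype) : D = D' := by
  have hmul : D.mul = D'.mul := LinearMap.ext₂ fun ξ ζ => (B.leftDualEquiv F).injective
    (((hD.isIso F).map_mul ξ ζ).trans ((hD'.isIso F).map_mul ξ ζ).symm)
  have hone : D.one = D'.one := (B.leftDualEquiv F).injective
    ((hD.isIso F).map_one.trans (hD'.isIso F).map_one.symm)
  have hη : D.η = D'.η := TensorProduct.ext' fun r s => B.leftDual_ext fun h =>
    (hD.env_apply r s.unop h).trans (hD'.env_apply r s.unop h).symm
  have hsrc : D.src = D'.src := congrArg (fun f => f ∘ₗ (TensorProduct.mk k R Rᵐᵒᵖ).flip 1) hη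
  have hΔ : (D.toWeak F).comul = (D'.toWeak F).comul := LinearMap.ext fun ξ =>
    (TensorProduct.congr (B.leftDualEquiv F) (B.leftDualEquiv F)).injective
      (((hD.isIso F).map_comul ξ).trans ((hD'.isIso F).map_comul ξ).symm)
  -- The axiom `τ(ξ|1) = C(ξ)(1)` gives only the value at `1`; the others follow from `C(ξ)(r) =
  -- C(ξr)(1)`.
  have hC : D.C = D'.C := LinearMap.ext₂ fun ξ r => by
    have h1 := hD.one_right (D.mul ξ (D.src r))
    have h2 := hD'.one_right (D'.mul ξ (D'.src r))
    rw [D.C_mul_src, mul_one] at h1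
    rw [D'.C_mul_src, mul_one] at h2
    rw [← h1, ← h2, hmul, hsrc]
  have hΓ := D.Γ_eq F
  have hΓ' := D'.Γ_eq F
  rw [hΔ] at hΓ
  -- The target of `Γ` is a quotient that depends on the ring structure. The common `Δ` has values
  -- in the tensor square over `k`, so it can be made a variable before the two ring structures are
  -- identified.
  generalize (D'.toWeak F).comul = Δ at hΓ hΓ'
  clear hD hD' hΔ hsrc
  obtain ⟨⟨mul, one, _, _, _, η, _, _⟩, Γ, _, _, _, C⟩ := D
  obtain ⟨⟨mul', one', _, _, _, η', _, _⟩, Γ', _, _, _, C'⟩ := D'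
  dsimp only at hmul hone hη hC
  subst hmul hone hη hC
  dsimp only at hΓ hΓ'
  obtain rfl : Γ = Γ' := hΓ.trans hΓ'.symm
  rfl

end IsSkewPairing

end

theorem mainTheorem8 {k R H : Type*} [Field k] [Ring R] [Algebra k R]
    [AddCommGroup H] [Module k H] [FiniteDimensional k H]
    (F : IdempotentFrobeniusSystem k R) (B : TakeuchiBialgebra k R H) :
    (B.toWeak F).IsWeakBialgebra ∧
    (B.toWeak F).dual.IsWeakBialgebra ∧
    (B.toWeak F).dual.op.IsWeakBialgebra ∧
    (∃! D : TakeuchiBialgebra k R B.leftDual, IsSkewPairing D B B.leftDual.subtype) ∧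
    ∀ D : TakeuchiBialgebra k R B.leftDual, IsSkewPairing D B B.leftDual.subtype →
      (D.toWeak F).IsWeakBialgebra ∧
      ∃ Φ : B.leftDual ≃ₗ[k] Module.Dual k H,
        (∀ (ξ : B.leftDual) (h : H), Φ ξ h = F.φ (ξ.1 h)) ∧
        (D.toWeak F).IsIso (B.toWeak F).dual.op Φ := by
  have hB := B.toWeak_isWeakBialgebra F
  have hdual := (B.toWeak F).isDual_dual.isWeakBialgebra hB
  exact ⟨hB, hdual, hdual.op,
    ⟨B.leftDualTakeuchi F, B.leftDualTakeuchi_isSkewPairing F,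
      fun D hD => IsSkewPairing.unique hD F (B.leftDualTakeuchi_isSkewPairing F)⟩,
    fun D hD => ⟨D.toWeak_isWeakBialgebra F, B.leftDualEquiv F,
      fun ξ h => B.leftDualEquiv_apply F ξ h, IsSkewPairing.isIso hD F⟩⟩
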